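/- Let $\mathbb D=\{z\in\mathbb C:|z|<1\}$. Let $\mathcal A$ be the class of functions $f(z)=z+\sum_{n\ge1}a_{n+1}z^{n+1}$ analytic and univalent in $\mathbb D$. Let $b,p,c\in\mathbb C$ with $c\neq0$ and $\kappa=p+\frac{b+1}{2}\notin\{0,-1,-2,\dots\}$, and let $\mu\in\mathbb R$, $\mu>-1$. For $f(z)=z+\sum_{n\ge1}a_{n+1}z^{n+1}$ analytic in $\mathbb D$ put $$B_{\kappa,c}(f)(z)=z+\sum_{n\ge1}a_{n+1}\frac{(-c/4)^n}{(\kappa)_n\,n!}z^{n+1},\qquad F_\mu(f)(z)=\frac{\mu+1}{z^\mu}\int_0^z t^{\mu-1}f(t)\,dt,$$ where $(\kappa)_n=\kappa(\kappa+1)\cdots(\kappa+n-1)$ and the integral is taken along the segment $[0,z]$. All quotients $B_{\kappa,c}(\cdot)(z)/z$ are extended analytically to $z=0$. Write $f\prec F$ if there is $w$ analytic in $\mathbb D$ with $|w(z)|\le|z|$ and $f(z)=F(w(z))$ for all $z\in\mathbb D$. Let $\mathcal H[1,1]$ be the class of functions $1+a_1z+a_2z^2+\cdots$ analytic in $\mathbb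 D$. Let $Q$ be the class of functions $q$ that are analytic and injective on $\overline{\mathbb D}\setminus E(q)$, with $q'(\zeta)\ne0$ for $\zeta\in\partial\mathbb D\setminus E(q)$, where $E(q)=\{\zeta\in\partial\mathbb D:\lim_{z\to\zeta}q(z)=\infty\}$. Let $f,g_1,g_2\in\mathcal A$ and $\omega_i(z)=B_{\kappa,c}(g_i)(z)/z$ for $i=1,2$. Suppose that for $i=1,2$ and all $z\in\mathbb D$ we have $\omega_i'(z)\neq0$ and $$\operatorname{Re}\left(1+\frac{z\omega_i''(z)}{\omega_i'(z)}\right)>-\gamma_\mu,\qquad \gamma_\mu=\frac{1+(\mu+1)^2-\sqrt{1+(\mu+1)^4}}{4(\mu+1)}.$$ Suppose also that $z\mapsto B_{\kappa,c}(f)(z)/z$ is univalent in $\mathbb D$ and that $z\mapsto B_{\kappa,c}(F_\mu(f))(z)/z$ belongs to $\mathcal H[1,1]\cap Q$. Then $$\omega_1(z)\prec\frac{B_{\kappa,c}(f)(z)}{z}\prec\omega_2(z)$$ implies $$\frac{B_{\kappa,c}(F_\mu(g_1))(z)}{z}\prec\frac{B_{\kappa,c}(F_\mu(f))(z)}{z}\prec\frac{B_{\kappa,c}(F_\mu(g_2))(z)}{z}.$$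 Moreover: (a) $\phi_1(z)=B_{\kappa,c}(F_\mu(g_1))(z)/z$ is the best subordinant of the differential superordination $$\omega_1(z)\prec P(z)+\frac{zP'(z)}{\mu+1}.$$ That is, $\omega_1$ is analytic in $\mathbb D$, $\phi_1$ is univalent in $\mathbb D$, and $\phi_1$ is a subordinant such that $q\prec\phi_1$ for every subordinant $q$. Here a subordinant is a function $q$ analytic in $\mathbb D$ with $q\prec P$ for every $P$ such that $P$ and $P+zP'/(\mu+1)$ are univalent in $\mathbb D$ and satisfy the superordination. (b) $\omega_2$ is univalent in $\mathbb D$, and $\phi_2(z)=B_{\kappa,c}(F_\mu(g_2))(z)/z$ is the best dominant of the differential subordination $$P(z)+\frac{zP'(z)}{\mu+1}\prec\omega_2(z).$$ That is, $\phi_2$ is a dominant such that $\phi_2\prec q$ for every dominant $q$. Here a dominant is a function $q$ univalent in $\mathbb D$ with $P\prec q$ for every $P$ analytic in $\mathbb D$ that satisfies the subordination. -/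

import Mathlib

open Filter Topology

noncomputable section

namespace Libera

/-- The open unit disc `𝔻`. -/
abbrev disc : Set ℂ := Metric.ball (0 : ℂ) 1

/-- Analytic functions in the unit disc (only the values on the disc matter). -/
def IsAnalytic (f : ℂ → ℂ) : Prop := AnalyticOnNhd ℂ f disc

/-- Analytic and injective in the unit disc. -/
def IsUnivalent (f : ℂ → ℂ) : Prop := IsAnalytic f ∧ Set.InjOn f disc

/-- The class `𝒜`: analytic univalent functions `f(z) = z + a₂ z² + …` in the unit disc. -/
def ClassA (f : ℂ → ℂ) : Prop := IsUnivalent f ∧ f 0 = 0 ∧ deriv f 0 = 1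

/-- The class `ℋ[a, n]`: analytic functions `f(z) = a + a_n z ^ n + a_{n+1} z ^ (n+1) + …`. -/
def ClassH (a : ℂ) (n : ℕ) (f : ℂ → ℂ) : Prop :=
  IsAnalytic f ∧ f 0 = a ∧ ∀ k : ℕ, 1 ≤ k → k < n → iteratedDeriv k f 0 = 0

/-- `f ≺ F`: there is `w` analytic in the disc with `|w(z)| ≤ |z|` and `f = F ∘ w` there. -/
def Subordinate (f F : ℂ → ℂ) : Prop :=
  ∃ w : ℂ → ℂ, IsAnalytic w ∧ (∀ z ∈ disc, ‖w z‖ ≤ ‖z‖) ∧ ∀ z ∈ disc, f z = F (w z)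

/-- `E(f)`: the boundary points of the disc at which `f` (on the disc) tends to infinity. -/
def exceptionalSet (f : ℂ → ℂ) : Set ℂ :=
  {ζ | ‖ζ‖ = 1 ∧ Tendsto f (𝓝[disc] ζ) (Bornology.cobounded ℂ)}

/-- The class `Q`: `f` is (extends to be) analytic and injective on the closed disc minus `E(f)`,
with nonvanishing derivative at the points of the unit circle outside `E(f)`. -/
def ClassQ (f : ℂ → ℂ) : Prop :=
  ∃ G : ℂ → ℂ, Set.EqOn G f disc ∧
    AnalyticOnNhd ℂ G (Metric.closedBall 0 1 \ exceptionalSet f) ∧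
    Set.InjOn G (Metric.closedBall 0 1 \ exceptionalSet f) ∧
    ∀ ζ ∈ Metric.sphere (0 : ℂ) 1 \ exceptionalSet f, deriv G ζ ≠ 0

/-- The `n`-th Taylor coefficient at the origin. -/
def taylorCoeff (f : ℂ → ℂ) (n : ℕ) : ℂ := iteratedDeriv n f 0 / (n.factorial : ℂ)

/-- The operator `B_{κ,c}`: for `f(z) = ∑_{n ≥ 0} a_{n+1} z ^ (n+1)`,
`B_{κ,c}(f)(z) = ∑_{n ≥ 0} a_{n+1} (-c/4) ^ n / ((κ)_n n!) z ^ (n+1)`. -/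
def besselOp (κ c : ℂ) (f : ℂ → ℂ) (z : ℂ) : ℂ :=
  ∑' n : ℕ, taylorCoeff f (n + 1) *
    ((-c / 4) ^ n / ((ascPochhammer ℂ n).eval κ * (n.factorial : ℂ))) * z ^ (n + 1)

/-- The function `h(z)/z`, for `h` with `h(0) = 0`, with its removable singularity at `0` filled
in. -/
def divZ (h : ℂ → ℂ) (z : ℂ) : ℂ := if z = 0 then deriv h 0 else h z / z

/-- The generalized Libera operator `F_μ(f)(z) = (μ+1) z^{-μ} ∫_0^z t^{μ-1} f(t) dt`, the integral
being along the segment `t = s z`, `0 < s < 1`. -/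
def libera (μ : ℝ) (f : ℂ → ℂ) (z : ℂ) : ℂ :=
  ((μ : ℂ) + 1) / z ^ (μ : ℂ) *
    ∫ s in (0 : ℝ)..1, ((s : ℂ) * z) ^ ((μ : ℂ) - 1) * f ((s : ℂ) * z) * z

/-- The constant `γ_μ`. -/
def gammaConst (μ : ℝ) : ℝ :=
  (1 + (μ + 1) ^ 2 - Real.sqrt (1 + (μ + 1) ^ 4)) / (4 * (μ + 1))

/-- `p` is a solution of the differential subordination `φ(p(z), z p'(z)) ≺ h(z)`. -/
def SolvesSubordination (φ : ℂ → ℂ → ℂ) (h p : ℂ → ℂ) : Prop :=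
  IsAnalytic p ∧ Subordinate (fun z => φ (p z) (z * deriv p z)) h

/-- `q` is a dominant of the solutions of `φ(p(z), z p'(z)) ≺ h(z)`. -/
def IsDominant (φ : ℂ → ℂ → ℂ) (h q : ℂ → ℂ) : Prop :=
  IsUnivalent q ∧ ∀ p : ℂ → ℂ, SolvesSubordination φ h p → Subordinate p q

/-- `q` is the best dominant of `φ(p(z), z p'(z)) ≺ h(z)`; the notion presupposes that `h` is
univalent, which is part of the assertion. -/
def IsBestDominant (φ : ℂ → ℂ → ℂ) (h q : ℂ → ℂ) : Prop :=
  IsUnivalent h ∧ IsDominant φ h q ∧ ∀ q' : ℂ → ℂ, IsDominant φ h q' → Subordinate q q'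

/-- `p` is a solution of the differential superordination `h(z) ≺ φ(p(z), z p'(z))`. -/
def SolvesSuperordination (φ : ℂ → ℂ → ℂ) (h p : ℂ → ℂ) : Prop :=
  IsUnivalent p ∧ IsUnivalent (fun z => φ (p z) (z * deriv p z)) ∧
    Subordinate h (fun z => φ (p z) (z * deriv p z))

/-- `q` is a subordinant of the solutions of `h(z) ≺ φ(p(z), z p'(z))`. -/
def IsSubordinant (φ : ℂ → ℂ → ℂ) (h q : ℂ → ℂ) : Prop :=
  IsAnalytic q ∧ ∀ p : ℂ → ℂ, SolvesSuperordination φ h p → Subordinate q p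

/-- `q` is the best subordinant of `h(z) ≺ φ(p(z), z p'(z))`; the notion presupposes that `h` is
analytic, which is part of the assertion. -/
def IsBestSubordinant (φ : ℂ → ℂ → ℂ) (h q : ℂ → ℂ) : Prop :=
  IsAnalytic h ∧ IsUnivalent q ∧ IsSubordinant φ h q ∧
    ∀ q' : ℂ → ℂ, IsSubordinant φ h q' → Subordinate q' q

end Libera

end

/-!
Write `β = μ + 1`, and let `φ` and `ω` be the quotients `B_{κ,c}(F_μ(g))(z) / z` and
`B_{κ,c}(g)(z) / z`. Comparing power series gives `φ + z φ' / β = ω` (`eqOn_chain_libera`), so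
everything reduces to the differential operator `p ↦ p + z p' / β` in the disc.

The lower bound on `Re (1 + z ω'' / ω')` forces `φ` to be a convex univalent function
(`isConvexMap_of_chain`): if `q = 1 + z φ'' / φ'` first reached the imaginary axis at `z₀`, Jack's
lemma (`exists_one_le_mul_deriv_eq_of_isMax`) would make `z₀ q'(z₀)` so negative that the bound on
`1 + z ω'' / ω' = q + z q' / (q + β)` fails there.

For a convex `f` the functions `f_t = f + t z f' / β`, `t ≥ 0`, are close-to-convex with respect to
`f`. Since `f` maps `|u| < |ζ|` into the half-plane bounded by the tangent at `f(ζ)`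
(`IsConvexMap.support`), and the difference quotients of `f_t ∘ f⁻¹` on the convex image have
positive real part (`IsConvexMap.re_div_pos`), one gets `f_t(u) ≠ f_s(ζ)` whenever `|u| < |ζ|` and
`t ≤ s` (`IsConvexMap.chain_ne`). This single fact serves both halves of the sandwich.

* If `p + z p' / β ≺ φ + z φ' / β` but `p ⊀ φ`, then at a first point of contact `p(z₀) = φ(ζ₀)`
  and `z₀ p'(z₀) = m ζ₀ φ'(ζ₀)` with `m ≥ 1` (`exists_contact_of_not_subordinate`), so `φ_m(ζ₀)`
  would be a value of `φ_1` at a point of modulus less than `|ζ₀|`.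
* If `φ + z φ' / β ≺ p + z p' / β =: H` with `p` and `H` univalent but `φ ⊀ p`, then at a first
  contact `H(ζ₀) = φ_{1/m}(z₀)` with `|z₀| < |ζ₀|`. The path `t ↦ φ_t(z₀)`, `1/m ≤ t ≤ 1`, never
  meets the image under `φ_1` of the circle `|ζ| = |ζ₀|`, so `φ_{1/m}(z₀) = φ_1(u) = H(v)` with
  `|v| ≤ |u| < |ζ₀|`, against the injectivity of `H`.

Finally `φ` itself solves both differential relations, so it is the best dominant and the best
subordinant.
-/

namespace Libera

open Metric Set MeasureTheory ComplexConjugate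

/-! ### Jack's lemma -/

/-- One half of Fermat's criterion: at a maximum from the left the derivative is nonnegative. -/
lemma nonneg_of_hasDerivAt_of_le_left {h : ℝ → ℝ} {d a : ℝ} (hd : HasDerivAt h d a)
    (hle : ∀ᶠ s in 𝓝[<] a, h s ≤ h a) : 0 ≤ d := by
  have ht : Tendsto (slope h a) (𝓝[<] a) (𝓝 d) :=
    (hasDerivAt_iff_tendsto_slope.1 hd).mono_left
      (nhdsWithin_mono _ fun x hx => ne_of_lt hx)
  refine ge_of_tendsto ht ?_
  filter_upwards [hle, self_mem_nhdsWithin] with s hs hlt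
  rw [slope_def_field]
  exact div_nonneg_of_nonpos (by linarith) (by simpa using hlt.le)

/-- Derivative of the squared norm of a holomorphic function along a curve. -/
lemma hasDerivAt_norm_sq_comp {w : ℂ → ℂ} {γ : ℝ → ℂ} {γ' : ℂ} {s : ℝ}
    (hw : DifferentiableAt ℂ w (γ s)) (hγ : HasDerivAt γ γ' s) :
    HasDerivAt (fun t => ‖w (γ t)‖ ^ 2) (2 * (γ' * deriv w (γ s) * conj (w (γ s))).re) s := by
  have h := (hw.hasDerivAt.comp s hγ).norm_sq
  refine h.congr_deriv ?_
  simp only [Function.comp_apply, Complex.inner]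
  congr 2
  ring

lemma hasDerivAt_ofReal_mul (z : ℂ) (s : ℝ) : HasDerivAt (fun t : ℝ => (t : ℂ) * z) z s := by
  simpa using (Complex.ofRealCLM.hasDerivAt (x := s)).mul_const z

lemma hasDerivAt_mul_exp_ofReal (z : ℂ) (θ : ℝ) :
    HasDerivAt (fun t : ℝ => z * Complex.exp (t * Complex.I))
      (Complex.I * (z * Complex.exp (θ * Complex.I))) θ := by
  have h := ((hasDerivAt_ofReal_mul Complex.I θ).cexp).const_mul z
  exact h.congr_deriv (by ring)

/-- The boundary form of the Schwarz lemma known as Jack's lemma: where a holomorphic function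
vanishing at the origin attains its maximum modulus on a closed disc, its logarithmic derivative
`z w'(z) / w(z)` is real and at least `1`. -/
theorem exists_one_le_mul_deriv_eq_of_isMax {w : ℂ → ℂ} {z₀ : ℂ} (hz₀ : z₀ ≠ 0)
    (hw : AnalyticOnNhd ℂ w (closedBall 0 ‖z₀‖)) (hw0 : w 0 = 0) (hne : w z₀ ≠ 0)
    (hmax : ∀ z ∈ closedBall (0 : ℂ) ‖z₀‖, ‖w z‖ ≤ ‖w z₀‖) :
    ∃ m : ℝ, 1 ≤ m ∧ z₀ * deriv w z₀ = m * w z₀ := by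
  have hr : 0 < ‖z₀‖ := norm_pos_iff.2 hz₀
  have hM : 0 < ‖w z₀‖ := norm_pos_iff.2 hne
  have hdiff : DifferentiableAt ℂ w z₀ := (hw z₀ (by simp)).differentiableAt
  -- Schwarz's lemma along the radius through `z₀` bounds the radial derivative from below.
  have hschwarz : ∀ s ∈ Ioo (0 : ℝ) 1, ‖w ((s : ℂ) * z₀)‖ ≤ s * ‖w z₀‖ := by
    intro s hs
    have hmem : (s : ℂ) * z₀ ∈ ball (0 : ℂ) ‖z₀‖ := by
      simp only [mem_ball_zero_iff, norm_mul, Complex.norm_real, Real.norm_eq_abs, abs_of_pos hs.1]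
      nlinarith [hs.2]
    have hmt : MapsTo w (ball 0 ‖z₀‖) (closedBall (w 0) ‖w z₀‖) := by
      intro z hz
      rw [hw0, mem_closedBall_zero_iff]
      exact hmax z (ball_subset_closedBall hz)
    have := Complex.dist_le_div_mul_dist_of_mapsTo_ball
      ((hw.mono ball_subset_closedBall).differentiableOn) hmt hmem
    rw [hw0, dist_zero_right, dist_zero_right, norm_mul, Complex.norm_real, Real.norm_eq_abs,
      abs_of_pos hs.1] at this
    refine this.trans_eq ?_
    field_simp
  set X : ℂ := z₀ * deriv w z₀ * conj (w z₀) with hX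
  have hre : ‖w z₀‖ ^ 2 ≤ X.re := by
    have h1 : HasDerivAt (fun t : ℝ => ‖w ((t : ℂ) * z₀)‖ ^ 2) (2 * X.re) 1 := by
      have := hasDerivAt_norm_sq_comp (w := w) (s := 1) (by simpa using hdiff)
        (hasDerivAt_ofReal_mul z₀ 1)
      simpa [hX] using this
    have h2 := h1.sub (((hasDerivAt_id (1 : ℝ)).pow 2).mul_const (‖w z₀‖ ^ 2))
    have := nonneg_of_hasDerivAt_of_le_left h2 (by
      filter_upwards [Ioo_mem_nhdsLT (zero_lt_one' ℝ)] with s hs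
      have := hschwarz s hs
      have h3 : ‖w ((s : ℂ) * z₀)‖ ^ 2 ≤ (s * ‖w z₀‖) ^ 2 := by gcongr
      simp only [Pi.sub_apply, Pi.pow_apply, id]
      simp only [Complex.ofReal_one, one_mul]
      nlinarith)
    simp at this
    linarith
  have him : X.im = 0 := by
    have h1 : HasDerivAt (fun t : ℝ => ‖w (z₀ * Complex.exp (t * Complex.I))‖ ^ 2)
        (2 * (Complex.I * X).re) 0 := by
      have := hasDerivAt_norm_sq_comp (w := w) (s := 0) (by simpa using hdiff)
        (hasDerivAt_mul_exp_ofReal z₀ 0)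
      simpa [hX, mul_assoc] using this
    have h2 : IsLocalMax (fun t : ℝ => ‖w (z₀ * Complex.exp (t * Complex.I))‖ ^ 2) 0 := by
      refine Eventually.of_forall fun t => ?_
      have := hmax (z₀ * Complex.exp (t * Complex.I)) (by simp [Complex.norm_exp_ofReal_mul_I])
      simp only [Complex.ofReal_zero, zero_mul, Complex.exp_zero, mul_one]
      gcongr
    have := h2.hasDerivAt_eq_zero h1
    simpa using this
  refine ⟨X.re / ‖w z₀‖ ^ 2, (one_le_div (by positivity)).2 hre, ?_⟩
  have hXre : X = (X.re : ℂ) := Complex.ext rfl (by simpa using him)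
  have hcw : conj (w z₀) ≠ 0 := by simpa using hne
  apply mul_right_cancel₀ hcw
  rw [← hX, mul_assoc, Complex.mul_conj']
  push_cast
  rw [div_mul_cancel₀ _ (by exact_mod_cast hM.ne'.elim ∘ fun h => by simpa using h)]
  exact hXre

/-! ### Univalent functions and their images -/

/-- An injective holomorphic function is open and has a holomorphic inverse on its image. The
inverse is continuous by the open mapping theorem and differentiable off the isolated critical
values, hence holomorphic by removability. -/
theorem exists_analytic_leftInverse {f : ℂ → ℂ} {U : Set ℂ} (hU : IsOpen U)
    (hf : AnalyticOnNhd ℂ f U) (hinj : InjOn f U) :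
    (∀ V ⊆ U, IsOpen V → IsOpen (f '' V)) ∧
      ∃ g : ℂ → ℂ, AnalyticOnNhd ℂ g (f '' U) ∧ ∀ z ∈ U, g (f z) = z := by
  have hUz : ∀ z ∈ U, ∀ᶠ x in 𝓝 z, x ∈ U := fun z hz => hU.mem_nhds hz
  have hnc : ∀ z ∈ U, ¬ ∀ᶠ x in 𝓝 z, f x = f z := by
    intro z hz h
    have h1 : ∀ᶠ x in 𝓝[≠] z, f x = f z ∧ x ∈ U ∧ x ≠ z :=
      ((h.filter_mono nhdsWithin_le_nhds).and
        (((hUz z hz).filter_mono nhdsWithin_le_nhds).and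
          self_mem_nhdsWithin))
    obtain ⟨x, hx, hxU, hxz⟩ := h1.exists
    exact hxz (hinj hxU hz hx)
  have hmap : ∀ z ∈ U, 𝓝 (f z) ≤ map f (𝓝 z) := fun z hz =>
    (hf z hz).eventually_constant_or_nhds_le_map_nhds.resolve_left (hnc z hz)
  have hopen : ∀ V ⊆ U, IsOpen V → IsOpen (f '' V) := by
    intro V hVU hV
    rw [isOpen_iff_mem_nhds]
    rintro _ ⟨z, hz, rfl⟩
    exact hmap z (hVU hz) (image_mem_map (hV.mem_nhds hz))
  set g := Function.invFunOn f U with hg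
  have hgf : ∀ z ∈ U, g (f z) = z := fun z hz => hinj.leftInvOn_invFunOn hz
  have hcont : ∀ z ∈ U, ContinuousAt g (f z) := by
    intro z hz
    rw [ContinuousAt, hgf z hz]
    intro V hV
    have hVU : V ∩ U ∈ 𝓝 z := inter_mem hV (hU.mem_nhds hz)
    have himg : f '' (V ∩ U) ∈ 𝓝 (f z) := hmap z hz (image_mem_map hVU)
    refine mem_map.2 (mem_of_superset himg ?_)
    rintro _ ⟨x, hx, rfl⟩
    rw [mem_preimage, hgf x hx.2]
    exact hx.1
  have hright : ∀ z ∈ U, ∀ᶠ y in 𝓝 (f z), f (g y) = y := by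
    intro z hz
    filter_upwards [(hopen U subset_rfl hU).mem_nhds (mem_image_of_mem f hz)]
    rintro _ ⟨x, hx, rfl⟩
    rw [hgf x hx]
  have hdiff : ∀ z ∈ U, deriv f z ≠ 0 → DifferentiableAt ℂ g (f z) := by
    intro z hz hz'
    refine (HasDerivAt.of_local_left_inverse (f := f) (hcont z hz) ?_ hz'
      (hright z hz)).differentiableAt
    rw [hgf z hz]
    exact (hf z hz).differentiableAt.hasDerivAt
  have hana : ∀ z ∈ U, AnalyticAt ℂ g (f z) := by
    intro z hz
    have hne : ∀ᶠ x in 𝓝[≠] z, deriv f x ≠ 0 := by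
      rcases (hf z hz).deriv.eventually_eq_zero_or_eventually_ne_zero with h | h
      · exfalso
        obtain ⟨ε, hε, hball⟩ := Metric.eventually_nhds_iff_ball.1
          (h.and (hUz z hz))
        refine hnc z hz (Metric.eventually_nhds_iff_ball.2 ⟨ε, hε, fun x hx => ?_⟩)
        exact isOpen_ball.is_const_of_deriv_eq_zero (convex_ball z ε).isPreconnected
          (fun y hy => (hf y (hball y hy).2).differentiableAt.differentiableWithinAt)
          (fun y hy => (hball y hy).1) hx (mem_ball_self hε)
      · exact h
    refine Complex.analyticAt_of_differentiable_on_punctured_nhds_of_continuousAt ?_ (hcont z hz)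
    have h1 : ∀ᶠ x in 𝓝 z, x ∈ U ∧ (x ≠ z → deriv f x ≠ 0) :=
      (hUz z hz).and (eventually_nhdsWithin_iff.1 hne)
    rw [eventually_nhdsWithin_iff]
    have himg : f '' {x | x ∈ U ∧ (x ≠ z → deriv f x ≠ 0)} ∈ 𝓝 (f z) :=
      hmap z hz (image_mem_map h1)
    filter_upwards [himg]
    rintro _ ⟨x, ⟨hxU, hx⟩, rfl⟩ hxz
    exact hdiff x hxU (hx fun h => hxz (by rw [h]; rfl))
  refine ⟨hopen, g, ?_, hgf⟩
  rintro _ ⟨z, hz, rfl⟩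
  exact hana z hz

/-- A connected set that meets the image of a disc and misses the image of the bounding circle lies
in the image of the disc. -/
theorem subset_image_ball_of_isPreconnected {f : ℂ → ℂ} {R : ℝ} {C : Set ℂ}
    (hf : ContinuousOn f (closedBall 0 R)) (hopen : IsOpen (f '' ball 0 R))
    (hC : IsPreconnected C) (hne : (C ∩ f '' ball 0 R).Nonempty)
    (hdisj : ∀ ζ, ‖ζ‖ = R → f ζ ∉ C) : C ⊆ f '' ball 0 R := by
  refine hC.subset_of_closure_inter_subset hopen hne ?_
  rintro y ⟨hy, hyC⟩
  have hcl : closure (f '' ball 0 R) ⊆ f '' closedBall 0 R :=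
    closure_minimal (image_mono ball_subset_closedBall)
      ((isCompact_closedBall 0 R).image_of_continuousOn hf).isClosed
  obtain ⟨ζ, hζ, rfl⟩ := hcl hy
  rw [mem_closedBall_zero_iff] at hζ
  rcases hζ.lt_or_eq with h | h
  · exact ⟨ζ, mem_ball_zero_iff.2 h, rfl⟩
  · exact absurd hyC (hdisj ζ h)

/-! ### Convex maps of the disc -/

/-- The analytic criterion for a locally univalent function of the disc to be convex:
`f' ≠ 0` and `Re (1 + z f''(z) / f'(z)) > 0`. -/
def IsConvexMap (f : ℂ → ℂ) : Prop :=
  IsAnalytic f ∧ ∀ z ∈ disc, deriv f z ≠ 0 ∧ 0 < (1 + z * deriv (deriv f) z / deriv f z).re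

lemma IsAnalytic.differentiableAt {f : ℂ → ℂ} (hf : IsAnalytic f) {z : ℂ} (hz : z ∈ disc) :
    DifferentiableAt ℂ f z := (hf z hz).differentiableAt

lemma IsAnalytic.deriv {f : ℂ → ℂ} (hf : IsAnalytic f) : IsAnalytic (deriv f) :=
  AnalyticOnNhd.deriv hf

/-- A logarithm of `f'`, up to a multiplicative constant. -/
lemma IsConvexMap.exists_log_deriv {f : ℂ → ℂ} (hf : IsConvexMap f) :
    ∃ (K : ℂ) (L : ℂ → ℂ), K ≠ 0 ∧ (∀ z ∈ disc, deriv f z = K * Complex.exp (L z)) ∧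
      ∀ z ∈ disc, HasDerivAt L (deriv (deriv f) z / deriv f z) z := by
  have hd : DifferentiableOn ℂ (fun z => deriv (deriv f) z / deriv f z) disc := fun z hz =>
    ((hf.1.deriv.deriv.differentiableAt hz).div (hf.1.deriv.differentiableAt hz)
      (hf.2 z hz).1).differentiableWithinAt
  obtain ⟨L, hL⟩ := hd.isExactOn_ball
  have h0 : (0 : ℂ) ∈ disc := mem_ball_self one_pos
  have hE : ∀ z ∈ disc, HasDerivAt (fun z => deriv f z * Complex.exp (-L z)) 0 z := by
    intro z hz
    have := (hf.1.deriv.differentiableAt hz).hasDerivAt.mul (hL z hz).neg.cexp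
    refine this.congr_deriv ?_
    have := (hf.2 z hz).1
    field_simp
    ring
  refine ⟨deriv f 0 * Complex.exp (-L 0), L, mul_ne_zero (hf.2 0 h0).1 (Complex.exp_ne_zero _),
    fun z hz => ?_, hL⟩
  have := isOpen_ball.is_const_of_deriv_eq_zero (convex_ball (0 : ℂ) 1).isPreconnected
    (fun y hy => (hE y hy).differentiableAt.differentiableWithinAt)
    (fun y hy => (hE y hy).deriv) h0 hz
  rw [this, mul_assoc, ← Complex.exp_add]
  simp

/-- On a circle the image of a convex map stays strictly on one side of each of its tangents.
The tangent direction turns monotonically, through a total angle `2π`, so the height above a fixed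
tangent first decreases and then increases back. -/
lemma IsConvexMap.support_circle {f : ℂ → ℂ} (hf : IsConvexMap f) {ζ : ℂ} (hζ : ζ ∈ disc)
    (hζ0 : ζ ≠ 0) {θ : ℝ} (hθ : θ ∈ Ioo 0 (2 * Real.pi)) :
    (f (ζ * Complex.exp (θ * Complex.I)) * conj (ζ * deriv f ζ)).re
      < (f ζ * conj (ζ * deriv f ζ)).re := by
  obtain ⟨K, L, hK, hfL, hL⟩ := hf.exists_log_deriv
  set c : ℝ → ℂ := fun t => ζ * Complex.exp (t * Complex.I) with hc
  have hcd : ∀ t, c t ∈ disc := fun t => by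
    simpa [hc, Complex.norm_exp_ofReal_mul_I] using hζ
  have hc' : ∀ t, HasDerivAt c (Complex.I * c t) t := fun t => hasDerivAt_mul_exp_ofReal ζ t
  set ν : ℂ := ζ * deriv f ζ with hν
  set k : ℝ → ℝ := fun t => (f (c t) * conj ν).re with hk
  -- `τ` is the angle from `ν` to the normal at `f (c t)`, and `A t` is the product of the lengths
  -- of these normals.
  set τ : ℝ → ℝ := fun t => t + (L (c t)).im - (L ζ).im with hτ
  set A : ℝ → ℝ := fun t => ‖ζ * K‖ ^ 2 * Real.exp ((L (c t)).re + (L ζ).re) with hA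
  have hApos : ∀ t, 0 < A t := fun t => by
    have : 0 < ‖ζ * K‖ := norm_pos_iff.2 (mul_ne_zero hζ0 hK)
    positivity
  have hτ' : ∀ t, HasDerivAt τ (1 + c t * deriv (deriv f) (c t) / deriv f (c t)).re t := by
    intro t
    have h1 : HasDerivAt (fun t => L (c t)) _ t := (hL _ (hcd t)).comp t (hc' t)
    have h2 := (Complex.imCLM.hasFDerivAt.comp_hasDerivAt t h1)
    have h3 := ((hasDerivAt_id t).add h2).sub_const (L ζ).im
    refine h3.congr_deriv ?_
    rw [show deriv (deriv f) (c t) / deriv f (c t) * (Complex.I * c t)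
      = Complex.I * (c t * deriv (deriv f) (c t) / deriv f (c t)) by ring]
    simp
  have hτmono : StrictMono τ := strictMono_of_hasDerivAt_pos hτ' fun t => (hf.2 _ (hcd t)).2
  have hτcont : Continuous τ := continuous_iff_continuousAt.2 fun t => (hτ' t).continuousAt
  have hτ0 : τ 0 = 0 := by simp [hτ, hc]
  have hτ2 : τ (2 * Real.pi) = 2 * Real.pi := by simp [hτ, hc, Complex.exp_two_pi_mul_I]
  have hk' : ∀ t, HasDerivAt k (-(A t * Real.sin (τ t))) t := by
    intro t
    have h1 : HasDerivAt (fun t => f (c t) * conj ν)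
        (deriv f (c t) * (Complex.I * c t) * conj ν) t :=
      ((hf.1.differentiableAt (hcd t)).hasDerivAt.comp t (hc' t)).mul_const _
    refine (Complex.reCLM.hasFDerivAt.comp_hasDerivAt t h1).congr_deriv ?_
    have h2 : deriv f (c t) * (Complex.I * c t) * conj ν
        = (‖ζ * K‖ ^ 2 : ℝ) * (Complex.I * Complex.exp (((L (c t)).re + (L ζ).re : ℝ)
          + (τ t : ℝ) * Complex.I)) := by
      have h3 : (((L (c t)).re + (L ζ).re : ℝ) : ℂ) + (τ t : ℝ) * Complex.I
          = L (c t) + conj (L ζ) + t * Complex.I := by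
        apply Complex.ext <;> simp [hτ]
        ring
      rw [h3, hν, hfL _ (hcd t), hfL _ hζ, Complex.exp_add, Complex.exp_add, Complex.exp_conj,
        Complex.ofReal_pow, ← Complex.mul_conj']
      simp only [hc, map_mul]
      ring
    rw [h2, Complex.exp_add, ← Complex.ofReal_exp, Complex.exp_mul_I, ← Complex.ofReal_cos,
      ← Complex.ofReal_sin]
    simp only [hA]
    simp [-Complex.ofReal_cos, -Complex.ofReal_sin, -Complex.ofReal_exp, -norm_mul,
      -Complex.ofReal_pow]
    ring
  have hkcont : Continuous k := continuous_iff_continuousAt.2 fun t => (hk' t).continuousAt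
  have hk0 : k 0 = (f ζ * conj ν).re := by simp [hk, hc]
  have hk2 : k (2 * Real.pi) = (f ζ * conj ν).re := by
    simp [hk, hc, Complex.exp_two_pi_mul_I]
  have hpi := Real.pi_pos
  obtain ⟨θ₁, hθ₁, hτ1⟩ := intermediate_value_Ioo (by positivity : (0 : ℝ) ≤ 2 * Real.pi)
    hτcont.continuousOn (show Real.pi ∈ Ioo (τ 0) (τ (2 * Real.pi)) by
      rw [hτ0, hτ2]; constructor <;> linarith)
  change k θ < _
  rcases le_total θ θ₁ with h | h
  · rw [← hk0]
    refine strictAntiOn_of_deriv_neg (convex_Icc 0 θ₁) hkcont.continuousOn (fun t ht => ?_)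
      (left_mem_Icc.2 hθ₁.1.le) ⟨hθ.1.le, h⟩ hθ.1
    rw [interior_Icc] at ht
    rw [(hk' t).deriv, neg_lt_zero]
    refine mul_pos (hApos t) (Real.sin_pos_of_pos_of_lt_pi ?_ ?_)
    · rw [← hτ0]; exact hτmono ht.1
    · rw [← hτ1]; exact hτmono ht.2
  · rw [← hk2]
    refine strictMonoOn_of_deriv_pos (convex_Icc θ₁ (2 * Real.pi)) hkcont.continuousOn
      (fun t ht => ?_) ⟨h, hθ.2.le⟩ (right_mem_Icc.2 hθ₁.2.le) hθ.2
    rw [interior_Icc] at ht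
    have h1 : Real.pi < τ t := by rw [← hτ1]; exact hτmono ht.1
    have h2 : τ t < 2 * Real.pi := by rw [← hτ2]; exact hτmono ht.2
    have h3 : 0 < Real.sin (2 * Real.pi - τ t) :=
      Real.sin_pos_of_pos_of_lt_pi (by linarith) (by linarith)
    rw [Real.sin_two_pi_sub] at h3
    rw [(hk' t).deriv, ← mul_neg]
    exact mul_pos (hApos t) h3

lemma exists_eq_mul_exp {u ζ : ℂ} (hζ : ζ ≠ 0) (h : ‖u‖ = ‖ζ‖) (hne : u ≠ ζ) :
    ∃ θ ∈ Ioo 0 (2 * Real.pi), u = ζ * Complex.exp ((θ : ℝ) * Complex.I) := by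
  have hn : ‖u / ζ‖ = 1 := by rw [norm_div, h, div_self (norm_ne_zero_iff.2 hζ)]
  have h1 : Complex.exp ((u / ζ).arg * Complex.I) = u / ζ := by
    have := Complex.norm_mul_exp_arg_mul_I (u / ζ)
    rwa [hn, Complex.ofReal_one, one_mul] at this
  have hpi := Real.pi_pos
  rcases lt_trichotomy (u / ζ).arg 0 with ha | ha | ha
  · refine ⟨(u / ζ).arg + 2 * Real.pi, ⟨?_, by linarith⟩, ?_⟩
    · have := Complex.neg_pi_lt_arg (u / ζ)
      linarith
    · push_cast
      rw [add_mul, Complex.exp_add, Complex.exp_two_pi_mul_I, mul_one, h1, mul_div_cancel₀ _ hζ]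
  · rw [ha] at h1
    simp only [Complex.ofReal_zero, zero_mul, Complex.exp_zero] at h1
    exact absurd ((div_eq_one_iff_eq hζ).1 h1.symm) hne
  · refine ⟨(u / ζ).arg, ⟨ha, ?_⟩, ?_⟩
    · have := Complex.arg_le_pi (u / ζ)
      linarith
    · rw [h1, mul_div_cancel₀ _ hζ]

/-- The image of the closed disc `|u| ≤ |ζ|` under a convex map lies on one side of the tangent at
`f(ζ)`, whose outer normal is `ζ f'(ζ)`, and meets it only at `f(ζ)`. -/
theorem IsConvexMap.support {f : ℂ → ℂ} (hf : IsConvexMap f) {u ζ : ℂ} (hζ : ζ ∈ disc)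
    (hu : ‖u‖ ≤ ‖ζ‖) (hne : u ≠ ζ) :
    0 < ((f ζ - f u) * conj (ζ * deriv f ζ)).re := by
  have hζ0 : ζ ≠ 0 := by
    rintro rfl
    exact hne (by simpa using hu)
  rw [sub_mul, Complex.sub_re, sub_pos]
  have hcirc : ∀ v, ‖v‖ = ‖ζ‖ → v ≠ ζ →
      (f v * conj (ζ * deriv f ζ)).re < (f ζ * conj (ζ * deriv f ζ)).re := by
    intro v hv hvζ
    obtain ⟨θ, hθ, rfl⟩ := exists_eq_mul_exp hζ0 hv hvζ
    exact hf.support_circle hζ hζ0 hθ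
  rcases hu.lt_or_eq with hlt | heq
  swap
  · exact hcirc u heq hne
  -- Inside the circle, the maximum principle applies to `exp (f · conj ν)`.
  set E : ℂ → ℂ := fun z => Complex.exp (f z * conj (ζ * deriv f ζ)) with hE
  have hr : 0 < ‖ζ‖ := norm_pos_iff.2 hζ0
  have hsub : closedBall (0 : ℂ) ‖ζ‖ ⊆ disc := closedBall_subset_ball (by simpa using hζ)
  have hEd : DifferentiableOn ℂ E (closedBall 0 ‖ζ‖) := fun z hz =>
    ((hf.1.differentiableAt (hsub hz)).mul_const _).cexp.differentiableWithinAt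
  have hEc : DiffContOnCl ℂ E (ball 0 ‖ζ‖) :=
    DifferentiableOn.diffContOnCl_ball hEd subset_rfl
  have hEn : ∀ z, ‖E z‖ = Real.exp ((f z * conj (ζ * deriv f ζ)).re) := fun z =>
    Complex.norm_exp _
  have hle : ∀ z ∈ closedBall (0 : ℂ) ‖ζ‖, ‖E z‖ ≤ ‖E ζ‖ := by
    intro z hz
    refine Complex.norm_le_of_forall_mem_frontier_norm_le isBounded_ball hEc ?_
      (by rwa [closure_ball _ hr.ne'])
    intro v hv
    rw [frontier_ball _ hr.ne', mem_sphere_zero_iff_norm] at hv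
    rcases eq_or_ne v ζ with rfl | hvζ
    · exact le_rfl
    · rw [hEn, hEn]
      exact Real.exp_le_exp.2 (hcirc v hv hvζ).le
  have hu' : u ∈ ball (0 : ℂ) ‖ζ‖ := by simpa using hlt
  have h1 := hle u (ball_subset_closedBall hu')
  rw [hEn, hEn, Real.exp_le_exp] at h1
  refine h1.lt_of_ne fun heq => ?_
  have hmax : IsMaxOn (norm ∘ E) (ball 0 ‖ζ‖) u := fun z hz => by
    have := hle z (ball_subset_closedBall hz)
    simp only [mem_ofPred_eq, Function.comp_apply]
    rwa [hEn u, heq, ← hEn]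
  have h2 := Complex.norm_eqOn_closure_of_isPreconnected_of_isMaxOn
    (convex_ball (0 : ℂ) ‖ζ‖).isPreconnected isOpen_ball hEc hu' hmax
  have h3 := h2 (show -ζ ∈ closure (ball (0 : ℂ) ‖ζ‖) by rw [closure_ball _ hr.ne']; simp)
  have h4 := hcirc (-ζ) (norm_neg ζ) (fun h => hζ0 (by simpa using neg_eq_self.1 h))
  simp only [Function.comp_apply, Function.const_apply] at h3
  rw [hEn, hEn, Real.exp_eq_exp] at h3
  linarith

lemma IsConvexMap.injOn {f : ℂ → ℂ} (hf : IsConvexMap f) : InjOn f disc := by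
  intro u hu v hv huv
  by_contra hne
  rcases le_total ‖u‖ ‖v‖ with h | h
  · have := hf.support hv h hne
    simp [huv] at this
  · have := hf.support hu h (Ne.symm hne)
    simp [huv] at this

lemma IsConvexMap.isUnivalent {f : ℂ → ℂ} (hf : IsConvexMap f) : IsUnivalent f :=
  ⟨hf.1, hf.injOn⟩

/-- The image of a disc `|z| < R` under a convex map is the intersection of its supporting
half-planes. -/
theorem IsConvexMap.convex_image {f : ℂ → ℂ} (hf : IsConvexMap f) {R : ℝ} (hR0 : 0 < R)
    (hR : R < 1) : Convex ℝ (f '' ball 0 R) := by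
  set C : Set ℂ := {w | ∀ ζ, ‖ζ‖ = R → 0 < ((f ζ - w) * conj (ζ * deriv f ζ)).re} with hC
  have hCconv : Convex ℝ C := by
    intro x hx y hy a b ha hb hab ζ hζ
    have h1 := hx ζ hζ
    have h2 := hy ζ hζ
    have h3 : (f ζ - (a • x + b • y)) * conj (ζ * deriv f ζ)
        = a • ((f ζ - x) * conj (ζ * deriv f ζ)) + b • ((f ζ - y) * conj (ζ * deriv f ζ)) := by
      have : (a : ℂ) + b = 1 := by exact_mod_cast hab
      simp only [Complex.real_smul]
      linear_combination (-(f ζ * conj (ζ * deriv f ζ))) * this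
    rw [h3, Complex.add_re, Complex.smul_re, Complex.smul_re, smul_eq_mul, smul_eq_mul]
    rcases ha.eq_or_lt with rfl | ha
    · have : b = 1 := by linarith
      simpa [this] using h2
    · have := mul_pos ha h1
      have := mul_nonneg hb h2.le
      linarith
  have hdisc : ∀ ζ : ℂ, ‖ζ‖ = R → ζ ∈ disc := fun ζ hζ => by
    rw [mem_ball_zero_iff, hζ]; exact hR
  have hsub : f '' ball 0 R ⊆ C := by
    rintro _ ⟨u, hu, rfl⟩ ζ hζ
    rw [mem_ball_zero_iff] at hu
    exact hf.support (hdisc ζ hζ) (by linarith) (fun h => by rw [h] at hu; linarith)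
  have hopen := (exists_analytic_leftInverse isOpen_ball hf.1 hf.injOn).1
    (ball 0 R) (ball_subset_ball hR.le) isOpen_ball
  have : C ⊆ f '' ball 0 R := by
    refine subset_image_ball_of_isPreconnected
      (fun z hz => (hf.1.differentiableAt
        (closedBall_subset_ball hR hz)).continuousAt.continuousWithinAt)
      hopen hCconv.isPreconnected ?_ ?_
    · have h0 : f 0 ∈ f '' ball 0 R := mem_image_of_mem f (mem_ball_self hR0)
      exact ⟨f 0, hsub h0, h0⟩
    · intro ζ hζ h
      have := h ζ hζ
      simp at this
  rw [hsub.antisymm this]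
  exact hCconv

/-- The Noshiro–Warschawski argument relative to a convex map `f`: if `Re (G' / f') > 0`, then the
difference quotients of `G ∘ f⁻¹` have positive real part. -/
theorem IsConvexMap.re_div_pos {f G : ℂ → ℂ} (hf : IsConvexMap f) (hG : IsAnalytic G)
    (hGf : ∀ z ∈ disc, 0 < (deriv G z / deriv f z).re) {u v : ℂ} (hu : u ∈ disc) (hv : v ∈ disc)
    (huv : u ≠ v) : 0 < ((G u - G v) / (f u - f v)).re := by
  obtain ⟨R, hR, hR1⟩ := exists_between (max_lt (mem_ball_zero_iff.1 hu) (mem_ball_zero_iff.1 hv))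
  have hR0 : 0 < R := (norm_nonneg u).trans_lt ((le_max_left _ _).trans_lt hR)
  obtain ⟨-, g, hg, hgf⟩ := exists_analytic_leftInverse isOpen_ball hf.1 hf.injOn
  have hfu : f u ∈ f '' ball 0 R :=
    mem_image_of_mem f (mem_ball_zero_iff.2 ((le_max_left _ _).trans_lt hR))
  have hfv : f v ∈ f '' ball 0 R :=
    mem_image_of_mem f (mem_ball_zero_iff.2 ((le_max_right _ _).trans_lt hR))
  set δ : ℂ := f u - f v with hδ
  have hδ0 : δ ≠ 0 := sub_ne_zero.2 fun h => huv (hf.injOn hu hv h)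
  set c : ℝ → ℂ := fun s => (s : ℂ) * δ + f v with hc
  have hcd : ∀ s ∈ Icc (0 : ℝ) 1, ∃ z ∈ disc, f z = c s := by
    intro s hs
    have h1 : c s ∈ f '' ball 0 R := by
      have := (hf.convex_image hR0 hR1) hfu hfv hs.1 (sub_nonneg.2 hs.2) (by ring)
      convert this using 1
      simp only [hc, hδ, Complex.real_smul]
      push_cast
      ring
    obtain ⟨z, hz, h⟩ := h1
    exact ⟨z, ball_subset_ball hR1.le hz, h⟩
  have hder : ∀ s ∈ Icc (0 : ℝ) 1, ∃ d > 0,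
      HasDerivAt (fun s => (G (g (c s)) / δ).re) d s := by
    intro s hs
    obtain ⟨z, hz, hzs⟩ := hcd s hs
    refine ⟨_, hGf z hz, ?_⟩
    have hg1 : HasDerivAt g (deriv f z)⁻¹ (f z) := by
      have h1 : HasDerivAt g (deriv g (f z)) (f z) :=
        (hg _ (mem_image_of_mem f hz)).differentiableAt.hasDerivAt
      have h2 : HasDerivAt (g ∘ f) (deriv g (f z) * deriv f z) z :=
        h1.comp z (hf.1.differentiableAt hz).hasDerivAt
      have h3 : HasDerivAt (g ∘ f) 1 z := by
        refine (hasDerivAt_id z).congr_of_eventuallyEq ?_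
        filter_upwards [isOpen_ball.mem_nhds hz] with x hx using hgf x hx
      rwa [eq_inv_of_mul_eq_one_left (h2.unique h3)] at h1
    have hc' : HasDerivAt c δ s := (hasDerivAt_ofReal_mul δ s).add_const _
    have h4 : HasDerivAt (fun s => g (c s)) ((deriv f z)⁻¹ * δ) s := by
      rw [hzs] at hg1
      exact hg1.comp s hc'
    have h5 : HasDerivAt (fun s => G (g (c s))) (deriv G z * ((deriv f z)⁻¹ * δ)) s := by
      have h6 : HasDerivAt G (deriv G z) (g (c s)) := by
        rw [← hzs, hgf z hz]
        exact (hG.differentiableAt hz).hasDerivAt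
      exact h6.comp s h4
    refine (Complex.reCLM.hasFDerivAt.comp_hasDerivAt s (h5.div_const δ)).congr_deriv ?_
    rw [Complex.reCLM_apply]
    congr 1
    field_simp
  have hmono : StrictMonoOn (fun s => (G (g (c s)) / δ).re) (Icc 0 1) := by
    refine strictMonoOn_of_deriv_pos (convex_Icc 0 1) (fun s hs => ?_) (fun s hs => ?_)
    · obtain ⟨d, _, h⟩ := hder s hs
      exact h.continuousAt.continuousWithinAt
    · rw [interior_Icc] at hs
      obtain ⟨d, hd, h⟩ := hder s (Ioo_subset_Icc_self hs)
      rw [h.deriv]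
      exact hd
  have := hmono (left_mem_Icc.2 zero_le_one) (right_mem_Icc.2 zero_le_one) one_pos
  simp only [hc, hδ, Complex.ofReal_zero, zero_mul, zero_add, Complex.ofReal_one, one_mul,
    sub_add_cancel, hgf u hu, hgf v hv] at this
  rw [sub_div, Complex.sub_re]
  linarith

/-! ### The subordination chain of a convex map -/

lemma re_div_eq (a b : ℂ) : (a / b).re = (a * conj b).re / ‖b‖ ^ 2 := by
  rw [Complex.div_re, ← Complex.normSq_eq_norm_sq, Complex.mul_re, Complex.conj_re, Complex.conj_im]
  ring

lemma zero_mem_disc : (0 : ℂ) ∈ disc := mem_ball_self one_pos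

lemma mem_disc_of_norm_le {w z : ℂ} (hz : z ∈ disc) (h : ‖w‖ ≤ ‖z‖) : w ∈ disc :=
  mem_ball_zero_iff.2 (h.trans_lt (mem_ball_zero_iff.1 hz))

/-- The family `z ↦ f(z) + t z f'(z) / β`, a subordination chain in `t ≥ 0` when `f` is convex. -/
noncomputable def chain (β : ℝ) (f : ℂ → ℂ) (t : ℝ) (z : ℂ) : ℂ := f z + t * (z * deriv f z / β)

section chain

variable {β : ℝ} {f : ℂ → ℂ}

lemma hasDerivAt_chain (hf : IsAnalytic f) (t : ℝ) {z : ℂ} (hz : z ∈ disc) :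
    HasDerivAt (chain β f t)
      (deriv f z + t * ((deriv f z + z * deriv (deriv f) z) / β)) z := by
  have h1 := (hf.differentiableAt hz).hasDerivAt
  have h2 := (hf.deriv.differentiableAt hz).hasDerivAt
  have h3 := ((((hasDerivAt_id z).mul h2).div_const (β : ℂ)).const_mul (t : ℂ))
  refine (h1.add h3).congr_deriv ?_
  simp

lemma isAnalytic_chain (hf : IsAnalytic f) (t : ℝ) : IsAnalytic (chain β f t) :=
  DifferentiableOn.analyticOnNhd
    (fun _ hz => (hasDerivAt_chain hf t hz).differentiableAt.differentiableWithinAt) isOpen_ball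

lemma IsConvexMap.re_deriv_chain_div_pos (hβ : 0 < β) (hf : IsConvexMap f) {t : ℝ} (ht : 0 ≤ t) :
    ∀ z ∈ disc, 0 < (deriv (chain β f t) z / deriv f z).re := by
  intro z hz
  obtain ⟨h0, hq⟩ := hf.2 z hz
  have : deriv (chain β f t) z / deriv f z
      = 1 + ((t / β : ℝ) : ℂ) * (1 + z * deriv (deriv f) z / deriv f z) := by
    rw [(hasDerivAt_chain hf.1 t hz).deriv]
    have : (β : ℂ) ≠ 0 := by exact_mod_cast hβ.ne'
    push_cast
    field_simp
  rw [this, Complex.add_re, Complex.re_ofReal_mul, Complex.one_re]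
  have := mul_nonneg (div_nonneg ht hβ.le) hq.le
  linarith

/-- The members of the chain are close-to-convex, hence univalent. -/
lemma IsConvexMap.isUnivalent_chain (hβ : 0 < β) (hf : IsConvexMap f) {t : ℝ} (ht : 0 ≤ t) :
    IsUnivalent (chain β f t) := by
  refine ⟨isAnalytic_chain hf.1 t, fun u hu v hv huv => ?_⟩
  by_contra hne
  have := hf.re_div_pos (isAnalytic_chain hf.1 t) (hf.re_deriv_chain_div_pos hβ ht) hu hv hne
  simp [huv] at this

/-- Outward rays avoid the image: along the ray issuing from a boundary point in the direction of
the outer normal `ζ f'(ζ)`, the chain leaves the image of the smaller discs for good. Were the two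
values equal, the quotient of `chain t u - chain t ζ`, a nonnegative multiple of the normal, by
`f u - f ζ`, which points into the supporting half-plane, would have nonpositive real part. -/
theorem IsConvexMap.chain_ne (hβ : 0 < β) (hf : IsConvexMap f) {t s : ℝ} (ht : 0 ≤ t) (hts : t ≤ s)
    {u ζ : ℂ} (hζ : ζ ∈ disc) (hu : ‖u‖ < ‖ζ‖) : chain β f t u ≠ chain β f s ζ := by
  intro heq
  have hud : u ∈ disc := mem_disc_of_norm_le hζ hu.le
  have hne : u ≠ ζ := fun h => hu.ne (by rw [h])
  have h1 := hf.re_div_pos (isAnalytic_chain hf.1 t) (hf.re_deriv_chain_div_pos hβ ht) hud hζ hne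
  have h2 := hf.support hζ hu.le hne
  set ν : ℂ := ζ * deriv f ζ with hν
  have h3 : chain β f t u - chain β f t ζ = (((s - t) / β : ℝ) : ℂ) * ν := by
    rw [heq]
    simp only [chain, hν]
    push_cast
    ring
  have hδ : f u - f ζ ≠ 0 := sub_ne_zero.2 fun h => hne (hf.injOn hud hζ h)
  rw [h3, mul_div_assoc, Complex.re_ofReal_mul, re_div_eq] at h1
  have h4 : (ν * conj (f u - f ζ)).re < 0 := by
    simp only [Complex.mul_re, Complex.conj_re, Complex.conj_im, Complex.sub_re, Complex.sub_im]
      at h2 ⊢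
    linarith
  have h5 : 0 ≤ (s - t) / β := div_nonneg (sub_nonneg.2 hts) hβ.le
  have h6 := mul_nonpos_of_nonneg_of_nonpos h5
    (div_nonpos_of_nonpos_of_nonneg h4.le (sq_nonneg ‖f u - f ζ‖))
  linarith

end chain

/-! ### Subordination -/

/-- First point of contact: if `p(0) = F(0)`, with `F` univalent, and `p` is not subordinate to `F`,
then the images of the circles `|z| = |z₀|` under `p` and `|ζ| = |ζ₀|` under `F` touch, where
`|z₀| < |ζ₀| < 1`, and their normals there are related by a factor `m ≥ 1`. -/
theorem exists_contact_of_not_subordinate {p F : ℂ → ℂ} (hp : IsAnalytic p) (hF : IsUnivalent F)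
    (h0 : p 0 = F 0) (hns : ¬ Subordinate p F) :
    ∃ (z₀ ζ₀ : ℂ) (m : ℝ), ζ₀ ∈ disc ∧ ‖z₀‖ < ‖ζ₀‖ ∧ 1 ≤ m ∧ p z₀ = F ζ₀ ∧
      z₀ * deriv p z₀ = m * (ζ₀ * deriv F ζ₀) := by
  obtain ⟨hop, g, hg, hgF⟩ := exists_analytic_leftInverse isOpen_ball hF.1 hF.2
  by_cases hall : ∀ R ∈ Ioo (0 : ℝ) 1, ∀ z ∈ ball (0 : ℂ) R, p z ∈ F '' ball 0 R
  · have hmem : ∀ z ∈ disc, ∀ R ∈ Ioo ‖z‖ 1, ∃ v ∈ disc, ‖v‖ < R ∧ F v = p z := by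
      intro z hz R hR
      obtain ⟨v, hv, hvz⟩ := hall R ⟨(norm_nonneg z).trans_lt hR.1, hR.2⟩ z
        (mem_ball_zero_iff.2 hR.1)
      exact ⟨v, ball_subset_ball hR.2.le hv, mem_ball_zero_iff.1 hv, hvz⟩
    have hex : ∀ z ∈ disc, ∃ v ∈ disc, F v = p z := by
      intro z hz
      obtain ⟨R, hR⟩ := exists_between (mem_ball_zero_iff.1 hz)
      obtain ⟨v, hv, _, h⟩ := hmem z hz R hR
      exact ⟨v, hv, h⟩
    refine absurd ⟨fun z => g (p z), ?_, ?_, ?_⟩ hns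
    · intro z hz
      obtain ⟨v, hv, hvz⟩ := hex z hz
      exact (hg (p z) (hvz ▸ mem_image_of_mem F hv)).comp (hp z hz)
    · intro z hz
      refine le_of_forall_gt_imp_ge_of_dense fun R hR => ?_
      rcases lt_or_ge R 1 with h1 | h1
      · obtain ⟨v, hv, hvR, hvz⟩ := hmem z hz R ⟨hR, h1⟩
        simp only [← hvz, hgF v hv]
        exact hvR.le
      · obtain ⟨v, hv, hvz⟩ := hex z hz
        simp only [← hvz, hgF v hv]
        exact (mem_ball_zero_iff.1 hv).le.trans h1
    · intro z hz
      obtain ⟨v, hv, hvz⟩ := hex z hz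
      simp only [← hvz, hgF v hv]
  · push Not at hall
    obtain ⟨R, hR, a, ha, hpa⟩ := hall
    rw [mem_ball_zero_iff] at ha
    have hopR : IsOpen (F '' ball 0 R) := hop _ (ball_subset_ball hR.2.le) isOpen_ball
    have had : closedBall (0 : ℂ) ‖a‖ ⊆ disc := closedBall_subset_ball (ha.trans hR.2)
    have hRd : closedBall (0 : ℂ) R ⊆ disc := closedBall_subset_ball hR.2
    -- `z₀` is a point of least modulus at which `p` is outside the image of `|ζ| < R`.
    have hclosed : IsClosed (closedBall (0 : ℂ) ‖a‖ ∩ p ⁻¹' (F '' ball 0 R)ᶜ) :=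
      (hp.continuousOn.mono had).preimage_isClosed_of_isClosed isClosed_closedBall
        hopR.isClosed_compl
    have hcpt : IsCompact (closedBall (0 : ℂ) ‖a‖ ∩ p ⁻¹' (F '' ball 0 R)ᶜ) :=
      (isCompact_closedBall 0 ‖a‖).of_isClosed_subset hclosed inter_subset_left
    obtain ⟨z₀, ⟨hz₀a, hz₀⟩, hmin⟩ := hcpt.exists_isMinOn ⟨a, by simp, hpa⟩
      continuous_norm.continuousOn
    rw [mem_closedBall_zero_iff] at hz₀a
    have hz₀R : ‖z₀‖ < R := hz₀a.trans_lt ha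
    have hin : ∀ z ∈ ball (0 : ℂ) ‖z₀‖, p z ∈ F '' ball 0 R := by
      intro z hz
      rw [mem_ball_zero_iff] at hz
      by_contra h
      have : ‖z₀‖ ≤ ‖z‖ := hmin ⟨mem_closedBall_zero_iff.2 (hz.le.trans hz₀a), h⟩
      linarith
    have hz₀0 : z₀ ≠ 0 := by
      rintro rfl
      exact hz₀ (h0 ▸ mem_image_of_mem F (mem_ball_self hR.1))
    have hz₀d : closedBall (0 : ℂ) ‖z₀‖ ⊆ disc := (closedBall_subset_closedBall hz₀a).trans had
    have hcl : IsClosed (F '' closedBall 0 R) :=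
      ((isCompact_closedBall 0 R).image_of_continuousOn (hF.1.continuousOn.mono hRd)).isClosed
    have hin' : ∀ z ∈ closedBall (0 : ℂ) ‖z₀‖, p z ∈ F '' closedBall 0 R := by
      intro z hz
      rw [← hcl.closure_eq]
      refine ContinuousWithinAt.mem_closure (s := ball 0 ‖z₀‖)
        (hp.differentiableAt (hz₀d hz)).continuousAt.continuousWithinAt ?_
        fun y hy => image_mono ball_subset_closedBall (hin y hy)
      rwa [closure_ball _ (norm_ne_zero_iff.2 hz₀0)]
    obtain ⟨ζ₀, hζ₀, hζz⟩ := hin' z₀ (by simp)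
    have hζ₀R : ‖ζ₀‖ = R := by
      refine (mem_closedBall_zero_iff.1 hζ₀).antisymm (not_lt.1 fun h => hz₀ ?_)
      exact hζz ▸ mem_image_of_mem F (mem_ball_zero_iff.2 h)
    have hζ₀0 : ζ₀ ≠ 0 := norm_ne_zero_iff.1 (hζ₀R ▸ hR.1.ne')
    have hw : AnalyticOnNhd ℂ (fun z => g (p z)) (closedBall 0 ‖z₀‖) := fun z hz =>
      (hg (p z) (image_mono hRd (hin' z hz))).comp (hp z (hz₀d hz))
    have hwz₀ : g (p z₀) = ζ₀ := by rw [← hζz, hgF ζ₀ (hRd hζ₀)]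
    obtain ⟨m, hm, hmz⟩ := exists_one_le_mul_deriv_eq_of_isMax hz₀0 hw
      (by rw [h0, hgF 0 zero_mem_disc]) (by rwa [hwz₀]) (by
        intro z hz
        obtain ⟨v, hv, hvz⟩ := hin' z hz
        rw [hwz₀, hζ₀R, ← hvz, hgF v (hRd hv)]
        exact mem_closedBall_zero_iff.1 hv)
    refine ⟨z₀, ζ₀, m, hRd hζ₀, hζ₀R ▸ hz₀R, hm, hζz.symm, ?_⟩
    have hz₀d' : z₀ ∈ disc := hz₀d (by simp)
    have h1 : HasDerivAt (fun z => F (g (p z))) (deriv F ζ₀ * deriv (fun z => g (p z)) z₀) z₀ := by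
      have h2 : HasDerivAt F (deriv F ζ₀) (g (p z₀)) := by
        rw [hwz₀]
        exact (hF.1.differentiableAt (hRd hζ₀)).hasDerivAt
      exact h2.comp z₀ (hw z₀ (by simp)).differentiableAt.hasDerivAt
    have h2 : HasDerivAt p (deriv F ζ₀ * deriv (fun z => g (p z)) z₀) z₀ := by
      refine h1.congr_of_eventuallyEq ?_
      have : F '' disc ∈ 𝓝 (p z₀) :=
        (hop disc subset_rfl isOpen_ball).mem_nhds (hζz ▸ mem_image_of_mem F (hRd hζ₀))
      filter_upwards [(hp.differentiableAt hz₀d').continuousAt this] with z hz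
      obtain ⟨v, hv, hvz⟩ := hz
      rw [← hvz, hgF v hv]
    rw [h2.deriv, mul_left_comm, hmz, hwz₀]
    ring

lemma Subordinate.refl (f : ℂ → ℂ) : Subordinate f f :=
  ⟨id, analyticOnNhd_id, fun _ _ => le_rfl, fun _ _ => rfl⟩

lemma Subordinate.congr {f f' F F' : ℂ → ℂ} (h : Subordinate f F) (hf : EqOn f f' disc)
    (hF : EqOn F F' disc) : Subordinate f' F' := by
  obtain ⟨w, hw, hwz, hfw⟩ := h
  exact ⟨w, hw, hwz, fun z hz => by
    rw [← hf hz, hfw z hz, hF (mem_disc_of_norm_le hz (hwz z hz))]⟩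

lemma Subordinate.apply_zero {f F : ℂ → ℂ} (h : Subordinate f F) : f 0 = F 0 := by
  obtain ⟨w, _, hwz, hfw⟩ := h
  have h0 : w 0 = 0 := by simpa using hwz 0 zero_mem_disc
  rw [hfw 0 zero_mem_disc, h0]

lemma IsUnivalent.congr {f g : ℂ → ℂ} (hf : IsUnivalent f) (h : EqOn f g disc) :
    IsUnivalent g :=
  ⟨hf.1.congr isOpen_ball h, hf.2.congr h⟩

section sandwich

variable {β : ℝ} {f : ℂ → ℂ}

/-- At a first contact, `chain β p 1` would take a value on an outward ray of `chain β f 1`. -/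
theorem IsConvexMap.subordinate_of_chain (hβ : 0 < β) (hf : IsConvexMap f) {p : ℂ → ℂ}
    (hp : IsAnalytic p) (h : Subordinate (chain β p 1) (chain β f 1)) : Subordinate p f := by
  by_contra hns
  obtain ⟨z₀, ζ₀, m, hζ₀, hlt, hm, heq, hder⟩ := exists_contact_of_not_subordinate hp
    hf.isUnivalent (by simpa [chain] using h.apply_zero) hns
  obtain ⟨w, _, hwz, hpw⟩ := h
  have hz₀ : z₀ ∈ disc := mem_disc_of_norm_le hζ₀ hlt.le
  refine hf.chain_ne hβ zero_le_one hm hζ₀ ((hwz z₀ hz₀).trans_lt hlt) ?_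
  rw [← hpw z₀ hz₀]
  simp only [chain, heq, hder]
  push_cast
  ring

/-- For `0 ≤ t ≤ 1` the values `chain β f t z₀` stay in the image of every larger disc under
`chain β f 1`, since they start there at `t = 1` and never meet the image of its boundary. -/
lemma IsConvexMap.chain_mem_image (hβ : 0 < β) (hf : IsConvexMap f) {t : ℝ} (ht : 0 ≤ t)
    (ht1 : t ≤ 1) {z₀ : ℂ} {R : ℝ} (hz₀ : ‖z₀‖ < R) (hR : R < 1) :
    chain β f t z₀ ∈ chain β f 1 '' ball 0 R := by
  have hU := hf.isUnivalent_chain hβ zero_le_one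
  have hsub : (fun s => chain β f s z₀) '' Icc t 1 ⊆ chain β f 1 '' ball 0 R := by
    refine subset_image_ball_of_isPreconnected
      (hU.1.continuousOn.mono (closedBall_subset_ball hR))
      ((exists_analytic_leftInverse isOpen_ball hU.1 hU.2).1 _ (ball_subset_ball hR.le)
        isOpen_ball) (isPreconnected_Icc.image _ ?_) ?_ ?_
    · unfold chain
      fun_prop
    · exact ⟨chain β f 1 z₀, mem_image_of_mem _ (right_mem_Icc.2 ht1),
        mem_image_of_mem _ (mem_ball_zero_iff.2 hz₀)⟩
    · rintro ζ hζ ⟨s, hs, hsζ⟩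
      exact hf.chain_ne hβ (ht.trans hs.1) hs.2 (mem_ball_zero_iff.2 (hζ.trans_lt hR))
        (hζ ▸ hz₀) hsζ
  exact hsub (mem_image_of_mem _ (left_mem_Icc.2 ht1))

/-- At a first contact, the univalent function `chain β p 1` would take the same value at `ζ₀` and
at a point of smaller modulus. -/
theorem IsConvexMap.subordinate_of_superordination (hβ : 0 < β) (hf : IsConvexMap f) {p : ℂ → ℂ}
    (hp : IsUnivalent p) (hH : InjOn (chain β p 1) disc)
    (h : Subordinate (chain β f 1) (chain β p 1)) : Subordinate f p := by
  by_contra hns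
  obtain ⟨z₀, ζ₀, m, hζ₀, hlt, hm, heq, hder⟩ := exists_contact_of_not_subordinate hf.1
    hp (by simpa [chain] using h.apply_zero) hns
  obtain ⟨w, _, hwz, hfw⟩ := h
  have hm0 : 0 < m := one_pos.trans_le hm
  obtain ⟨u, hu, huz⟩ := hf.chain_mem_image hβ (inv_nonneg.2 hm0.le)
    (inv_le_one_of_one_le₀ hm) hlt (mem_ball_zero_iff.1 hζ₀)
  rw [mem_ball_zero_iff] at hu
  have hud : u ∈ disc := mem_disc_of_norm_le hζ₀ hu.le
  have hwu := hwz u hud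
  have h1 : chain β p 1 (w u) = chain β p 1 ζ₀ := by
    rw [← hfw u hud, huz]
    have : (m : ℂ) ≠ 0 := by exact_mod_cast hm0.ne'
    simp only [chain, heq, hder]
    push_cast
    field_simp
  have h2 := hH (mem_disc_of_norm_le hud hwu) hζ₀ h1
  rw [h2] at hwu
  linarith

end sandwich

/-! ### Convexity from the differential relation -/

section convexity

variable {β : ℝ} {f : ℂ → ℂ}

lemma re_one_add_div_eq {f : ℂ → ℂ} {z : ℂ} (h : deriv f z ≠ 0) :
    (1 + z * deriv (deriv f) z / deriv f z).re
      = ((deriv f z + z * deriv (deriv f) z) * conj (deriv f z)).re / ‖deriv f z‖ ^ 2 := by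
  rw [← re_div_eq, add_div, div_self h]

/-- The derivative cannot vanish on the boundary of a disc in which `Re (1 + z f'' / f') > 0`, as
`|z f'(z)|` increases along radii. -/
lemma deriv_ne_zero_of_radial (hf : IsAnalytic f) {z : ℂ} (hz : z ∈ disc)
    (h : ∀ x : ℂ, ‖x‖ < ‖z‖ → 0 < ((deriv f x + x * deriv (deriv f) x) * conj (deriv f x)).re) :
    z ≠ 0 → deriv f z ≠ 0 := by
  intro hz0 hfz
  have hpos : 0 < ‖z‖ := norm_pos_iff.2 hz0
  have hsd : ∀ s ∈ Icc (0 : ℝ) 1, (s : ℂ) * z ∈ disc := fun s hs => by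
    refine mem_disc_of_norm_le hz ?_
    rw [norm_mul, Complex.norm_real, Real.norm_eq_abs, abs_of_nonneg hs.1]
    exact mul_le_of_le_one_left hpos.le hs.2
  have hN : ∀ s ∈ Icc (0 : ℝ) 1, HasDerivAt (fun t : ℝ => t ^ 2 * ‖deriv f ((t : ℂ) * z)‖ ^ 2)
      (2 * s * ((deriv f (s * z) + s * z * deriv (deriv f) (s * z))
        * conj (deriv f (s * z))).re) s := by
    intro s hs
    have h1 := hasDerivAt_norm_sq_comp (γ := fun t : ℝ => (t : ℂ) * z)
      (hf.deriv.differentiableAt (hsd s hs))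
      (hasDerivAt_ofReal_mul z s)
    refine (((hasDerivAt_id s).pow 2).mul h1).congr_deriv ?_
    rw [add_mul, Complex.add_re, Complex.mul_conj', ← Complex.ofReal_pow, Complex.ofReal_re,
      mul_assoc (s : ℂ), mul_assoc (s : ℂ), Complex.re_ofReal_mul]
    simp only [id, Pi.pow_apply]
    push_cast
    ring
  have hmono : StrictMonoOn (fun t : ℝ => t ^ 2 * ‖deriv f ((t : ℂ) * z)‖ ^ 2) (Icc 0 1) := by
    refine strictMonoOn_of_deriv_pos (convex_Icc 0 1)
      (fun s hs => (hN s hs).continuousAt.continuousWithinAt) fun s hs => ?_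
    rw [interior_Icc] at hs
    rw [(hN s (Ioo_subset_Icc_self hs)).deriv]
    refine mul_pos (by linarith [hs.1]) (h _ ?_)
    rw [norm_mul, Complex.norm_real, Real.norm_eq_abs, abs_of_pos hs.1]
    exact mul_lt_of_lt_one_left hpos hs.2
  have := hmono (left_mem_Icc.2 zero_le_one) (right_mem_Icc.2 zero_le_one) one_pos
  simp [hfz] at this

/-- The differential relation between `f` and `ω = f + z f' / β` passes the convexity defect of `ω`
on to `f`: with `q = 1 + z f'' / f'` one has `1 + z ω'' / ω' = q + z q' / (q + β)`. At a first point
with `Re q = 0`, Jack's lemma for `(q - 1) / (q + 1)` gives `z q' ≤ -(1 + |q|²) / 2`, and the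
right-hand side has real part at most `-β (1 + |q|²) / (2 (β² + |q|²))`. -/
theorem isConvexMap_of_chain (hβ : 0 < β) (hf : IsAnalytic f) {γ : ℝ} (hγ : 4 * γ ≤ β)
    (hγ' : 4 * γ * β ≤ 1)
    (h : ∀ z ∈ disc, deriv (chain β f 1) z ≠ 0 ∧
      -γ < (z * deriv (deriv (chain β f 1)) z / deriv (chain β f 1) z + 1).re) :
    IsConvexMap f := by
  have hβ0 : (β : ℂ) ≠ 0 := by exact_mod_cast hβ.ne'
  -- `J = |f'|² Re (1 + z f'' / f')`, written so as to be continuous also at zeros of `f'`.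
  set J : ℂ → ℝ := fun z => ((deriv f z + z * deriv (deriv f) z) * conj (deriv f z)).re with hJ
  have hJc : ContinuousOn J disc := by
    have h1 := hf.deriv.continuousOn
    have h2 := hf.deriv.deriv.continuousOn
    exact Complex.continuous_re.comp_continuousOn
      ((h1.add (continuousOn_id.mul h2)).mul (Complex.continuous_conj.comp_continuousOn h1))
  suffices hpos : ∀ z ∈ disc, 0 < J z by
    refine ⟨hf, fun z hz => ?_⟩
    have h1 := hpos z hz
    have h0 : deriv f z ≠ 0 := by
      intro h0
      simp [hJ, h0] at h1
    rw [re_one_add_div_eq h0]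
    exact ⟨h0, div_pos h1 (by have := norm_pos_iff.2 h0; positivity)⟩
  by_contra! hneg
  obtain ⟨a, ha, hJa⟩ := hneg
  have had : closedBall (0 : ℂ) ‖a‖ ⊆ disc := closedBall_subset_ball (mem_ball_zero_iff.1 ha)
  have hclosed : IsClosed (closedBall (0 : ℂ) ‖a‖ ∩ J ⁻¹' Iic 0) :=
    (hJc.mono had).preimage_isClosed_of_isClosed isClosed_closedBall isClosed_Iic
  -- `z₀` is a point of least modulus with `J z₀ ≤ 0`.
  obtain ⟨z₀, ⟨hz₀a, hz₀⟩, hmin⟩ := ((isCompact_closedBall (0 : ℂ) ‖a‖).of_isClosed_subset hclosed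
    inter_subset_left).exists_isMinOn ⟨a, by simp, hJa⟩ continuous_norm.continuousOn
  rw [mem_closedBall_zero_iff] at hz₀a
  have hin : ∀ z : ℂ, ‖z‖ < ‖z₀‖ → 0 < J z := by
    intro z hz
    by_contra! hcon
    have : ‖z₀‖ ≤ ‖z‖ := hmin ⟨mem_closedBall_zero_iff.2 (hz.le.trans hz₀a), hcon⟩
    linarith
  have h00 : deriv f 0 ≠ 0 := by
    intro h0
    refine (h 0 zero_mem_disc).1 ?_
    rw [(hasDerivAt_chain hf 1 zero_mem_disc).deriv, h0]
    simp
  have hz₀0 : z₀ ≠ 0 := by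
    rintro rfl
    have h1 : 0 < ‖deriv f 0‖ := norm_pos_iff.2 h00
    simp only [hJ, mem_preimage, mem_Iic, zero_mul, add_zero, Complex.mul_conj',
      ← Complex.ofReal_pow, Complex.ofReal_re] at hz₀
    nlinarith
  have hsub : closedBall (0 : ℂ) ‖z₀‖ ⊆ disc := (closedBall_subset_closedBall hz₀a).trans had
  have hne : ∀ z ∈ closedBall (0 : ℂ) ‖z₀‖, deriv f z ≠ 0 := by
    intro z hz
    rcases eq_or_ne z 0 with rfl | hz0
    · exact h00
    · exact deriv_ne_zero_of_radial hf (hsub hz)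
        (fun x hx => hin x (hx.trans_le (mem_closedBall_zero_iff.1 hz))) hz0
  have hJnn : ∀ z ∈ closedBall (0 : ℂ) ‖z₀‖, 0 ≤ J z := by
    intro z hz
    rw [← mem_Ici, ← isClosed_Ici.closure_eq]
    refine ContinuousWithinAt.mem_closure (s := ball 0 ‖z₀‖)
      (hJc.continuousAt (isOpen_ball.mem_nhds (hsub hz))).continuousWithinAt ?_
      fun y hy => (hin y (mem_ball_zero_iff.1 hy)).le
    rwa [closure_ball _ (norm_ne_zero_iff.2 hz₀0)]
  have hz₀m : z₀ ∈ closedBall (0 : ℂ) ‖z₀‖ := by simp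
  have hz₀d := hsub hz₀m
  set q : ℂ → ℂ := fun z => 1 + z * deriv (deriv f) z / deriv f z with hq
  have hqa : AnalyticOnNhd ℂ q (closedBall 0 ‖z₀‖) := fun z hz =>
    analyticAt_const.add ((analyticAt_id.mul (hf.deriv.deriv z (hsub hz))).div
      (hf.deriv z (hsub hz)) (hne z hz))
  have hqre : ∀ z ∈ closedBall (0 : ℂ) ‖z₀‖, 0 ≤ (q z).re := fun z hz => by
    simp only [hq]
    rw [re_one_add_div_eq (hne z hz)]
    exact div_nonneg (hJnn z hz) (sq_nonneg _)
  have hq0 : (q z₀).re = 0 := by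
    refine le_antisymm ?_ (hqre z₀ hz₀m)
    simp only [hq]
    rw [re_one_add_div_eq (hne z₀ hz₀m)]
    exact div_nonpos_of_nonpos_of_nonneg hz₀ (sq_nonneg _)
  set ρ : ℝ := (q z₀).im with hρ
  have hqρ : q z₀ = ρ * Complex.I := by
    apply Complex.ext <;> simp [hq0, hρ]
  have hq1 : ∀ z ∈ closedBall (0 : ℂ) ‖z₀‖, q z + 1 ≠ 0 := fun z hz h0 => by
    have h1 := hqre z hz
    have h2 := congrArg Complex.re h0
    simp at h2
    linarith
  have hqd : HasDerivAt q (deriv q z₀) z₀ := (hqa z₀ hz₀m).differentiableAt.hasDerivAt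
  -- The Cayley transform of `q` attains its maximum modulus at `z₀`.
  have hwa : AnalyticOnNhd ℂ (fun z => (q z - 1) / (q z + 1)) (closedBall 0 ‖z₀‖) := fun z hz =>
    ((hqa z hz).sub analyticAt_const).div ((hqa z hz).add analyticAt_const) (hq1 z hz)
  have hcayley : ∀ z ∈ closedBall (0 : ℂ) ‖z₀‖, ‖(q z - 1) / (q z + 1)‖ ≤ 1 := fun z hz => by
    rw [norm_div]
    refine div_le_one_of_le₀ ?_ (norm_nonneg _)
    rw [← sq_le_sq₀ (norm_nonneg _) (norm_nonneg _), ← Complex.normSq_eq_norm_sq,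
      ← Complex.normSq_eq_norm_sq, Complex.normSq_apply, Complex.normSq_apply]
    have := hqre z hz
    simp
    nlinarith
  have hcayley₀ : ‖(q z₀ - 1) / (q z₀ + 1)‖ = 1 := by
    rw [norm_div, hqρ, div_eq_one_iff_eq (by rw [← hqρ]; exact norm_ne_zero_iff.2 (hq1 z₀ hz₀m)),
      ← sq_eq_sq₀ (norm_nonneg _) (norm_nonneg _), ← Complex.normSq_eq_norm_sq,
      ← Complex.normSq_eq_norm_sq, Complex.normSq_apply, Complex.normSq_apply]
    simp
  obtain ⟨m, hm, hmz⟩ := exists_one_le_mul_deriv_eq_of_isMax hz₀0 hwa (by simp [hq])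
    (norm_ne_zero_iff.1 (by rw [hcayley₀]; exact one_ne_zero))
    (fun z hz => by rw [hcayley₀]; exact hcayley z hz)
  have hσ : z₀ * deriv q z₀ = ((-(m * (1 + ρ ^ 2) / 2) : ℝ) : ℂ) := by
    have h1 := hq1 z₀ hz₀m
    have hd : deriv (fun z => (q z - 1) / (q z + 1)) z₀ = 2 * deriv q z₀ / (q z₀ + 1) ^ 2 := by
      refine ((hqd.sub_const 1).div (hqd.add_const 1) h1).deriv.trans ?_
      ring
    rw [hd] at hmz
    have h2 : 2 * (z₀ * deriv q z₀) = m * (q z₀ ^ 2 - 1) := by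
      field_simp at hmz
      linear_combination hmz
    rw [hqρ, mul_pow, Complex.I_sq] at h2
    push_cast
    linear_combination h2 / 2
  have hω : ∀ z ∈ closedBall (0 : ℂ) ‖z₀‖,
      deriv (chain β f 1) z = deriv f z * (q z + β) / β := fun z hz => by
    rw [(hasDerivAt_chain hf 1 (hsub hz)).deriv]
    have := hne z hz
    simp only [hq]
    push_cast
    field_simp
    ring
  have hω' : deriv (deriv (chain β f 1)) z₀
      = (deriv (deriv f) z₀ * (q z₀ + β) + deriv f z₀ * deriv q z₀) / β := by
    have h1 := (((hf.deriv.differentiableAt hz₀d).hasDerivAt.mul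
      (hqd.add_const (β : ℂ))).div_const (β : ℂ))
    refine (h1.congr_of_eventuallyEq ?_).deriv
    have hev : ∀ᶠ z in 𝓝 z₀, deriv f z ≠ 0 ∧ z ∈ disc :=
      ((hf.deriv.differentiableAt hz₀d).continuousAt.eventually_ne (hne z₀ hz₀m)).and
        (isOpen_ball.mem_nhds hz₀d)
    filter_upwards [hev] with z hz
    rw [(hasDerivAt_chain hf 1 hz.2).deriv]
    have := hz.1
    simp only [hq, Pi.mul_apply]
    push_cast
    field_simp
    ring
  have hqβ : q z₀ + β ≠ 0 := fun h0 => by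
    have h2 := congrArg Complex.re h0
    simp [hq0] at h2
    exact hβ.ne' h2
  have hkey := (h z₀ hz₀d).2
  have hexpr : z₀ * deriv (deriv (chain β f 1)) z₀ / deriv (chain β f 1) z₀ + 1
      = q z₀ + (z₀ * deriv q z₀) / (q z₀ + β) := by
    rw [hω', hω z₀ hz₀m]
    have := hne z₀ hz₀m
    have h3 : z₀ * deriv (deriv f) z₀ = (q z₀ - 1) * deriv f z₀ := by
      simp only [hq]
      field_simp
      ring
    field_simp
    linear_combination (q z₀ + β) * h3
  rw [hexpr, hσ, Complex.add_re, hq0, zero_add, re_div_eq, Complex.re_ofReal_mul,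
    ← Complex.normSq_eq_norm_sq, Complex.normSq_apply, hqρ] at hkey
  simp only [Complex.conj_re, Complex.add_re, Complex.mul_re, Complex.ofReal_re, Complex.I_re,
    mul_zero, Complex.ofReal_im, Complex.I_im, sub_zero, zero_add, Complex.add_im,
    Complex.mul_im, mul_one, add_zero] at hkey
  rw [lt_div_iff₀ (by nlinarith [mul_pos hβ hβ, mul_self_nonneg ρ])] at hkey
  nlinarith [mul_le_mul_of_nonneg_right hγ (sq_nonneg ρ), mul_le_mul_of_nonneg_right hγ' hβ.le,
    mul_le_mul_of_nonneg_right hm (by positivity : 0 ≤ (1 + ρ ^ 2) * β),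
    mul_pos hβ (by positivity : 0 < 1 + ρ ^ 2)]

end convexity

/-! ### Best dominants and best subordinants -/

section best

variable {β : ℝ} {f ω : ℂ → ℂ}

/-- A convex `f` is the best dominant of `p + z p' / β ≺ f + z f' / β`. -/
theorem IsConvexMap.isBestDominant (hβ : 0 < β) (hf : IsConvexMap f)
    (hω : EqOn ω (chain β f 1) disc) :
    IsBestDominant (fun u v => u + v / (β : ℂ)) ω f := by
  have hchain : ∀ p : ℂ → ℂ, (fun z => p z + z * deriv p z / (β : ℂ)) = chain β p 1 := fun p => by
    funext z
    simp [chain]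
  refine ⟨(hf.isUnivalent_chain hβ zero_le_one).congr hω.symm, ⟨hf.isUnivalent, ?_⟩, ?_⟩
  · rintro p ⟨hp, h⟩
    rw [hchain] at h
    exact hf.subordinate_of_chain hβ hp (h.congr (fun _ _ => rfl) hω)
  · rintro q ⟨_, hq⟩
    refine hq f ⟨hf.1, ?_⟩
    rw [hchain]
    exact (Subordinate.refl _).congr (fun _ _ => rfl) hω.symm

/-- A convex `f` is the best subordinant of `f + z f' / β ≺ p + z p' / β`. -/
theorem IsConvexMap.isBestSubordinant (hβ : 0 < β) (hf : IsConvexMap f)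
    (hω : EqOn ω (chain β f 1) disc) :
    IsBestSubordinant (fun u v => u + v / (β : ℂ)) ω f := by
  have hchain : ∀ p : ℂ → ℂ, (fun z => p z + z * deriv p z / (β : ℂ)) = chain β p 1 := fun p => by
    funext z
    simp [chain]
  have hU := hf.isUnivalent_chain hβ zero_le_one
  refine ⟨(hU.congr hω.symm).1, hf.isUnivalent, ⟨hf.1, ?_⟩, ?_⟩
  · rintro p ⟨hp, hH, h⟩
    rw [hchain] at h hH
    exact hf.subordinate_of_superordination hβ hp hH.2 (h.congr hω (fun _ _ => rfl))
  · rintro q ⟨_, hq⟩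
    refine hq f ⟨hf.isUnivalent, ?_, ?_⟩
    · rwa [hchain]
    · rw [hchain]
      exact (Subordinate.refl _).congr hω.symm (fun _ _ => rfl)

end best

/-! ### Power series in the disc -/

/-- `F` is the sum of the power series `∑ aₙ zⁿ` in the unit disc. -/
def HasDiscSeries (a : ℕ → ℂ) (F : ℂ → ℂ) : Prop :=
  ∀ z ∈ disc, HasSum (fun n => a n * z ^ n) (F z)

lemma IsAnalytic.hasDiscSeries {f : ℂ → ℂ} (hf : IsAnalytic f) :
    HasDiscSeries (taylorCoeff f) f := by
  intro z hz
  have := Complex.hasSum_taylorSeries_on_ball hf.differentiableOn hz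
  refine HasSum.congr_fun this fun n => ?_
  rw [taylorCoeff, sub_zero, smul_eq_mul, smul_eq_mul]
  ring

section series

variable {a : ℕ → ℂ} {F : ℂ → ℂ}

lemma HasDiscSeries.summable_norm (h : HasDiscSeries a F) {r : ℝ} (hr0 : 0 ≤ r) (hr : r < 1) :
    Summable fun n => ‖a n‖ * r ^ n := by
  have hz : (r : ℂ) ∈ disc := by simpa [abs_of_nonneg hr0] using hr
  simpa [abs_of_nonneg hr0] using (h r hz).summable.norm

lemma HasDiscSeries.hasFPowerSeriesOnBall (h : HasDiscSeries a F) :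
    HasFPowerSeriesOnBall F (FormalMultilinearSeries.ofScalars ℂ a) 0 1 := by
  refine ⟨?_, one_pos, ?_⟩
  · refine ENNReal.le_of_forall_nnreal_lt fun r hr => ?_
    refine FormalMultilinearSeries.le_radius_of_summable_norm _ ?_
    simp only [FormalMultilinearSeries.ofScalars_norm]
    exact h.summable_norm r.coe_nonneg (by exact_mod_cast hr)
  · intro y hy
    have hy' : y ∈ disc := by
      rwa [← ENNReal.coe_one, Metric.eball_coe, NNReal.coe_one] at hy
    simpa only [zero_add, FormalMultilinearSeries.ofScalars_apply_eq, smul_eq_mul] using h y hy'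

lemma HasDiscSeries.isAnalytic (h : HasDiscSeries a F) : IsAnalytic F := by
  have := h.hasFPowerSeriesOnBall.analyticOnNhd
  rwa [← ENNReal.coe_one, Metric.eball_coe, NNReal.coe_one] at this

lemma HasDiscSeries.taylorCoeff_eq (h : HasDiscSeries a F) (n : ℕ) : taylorCoeff F n = a n := by
  have h1 := (h.isAnalytic 0 zero_mem_disc).hasFPowerSeriesAt
  have h2 := h1.eq_formalMultilinearSeries h.hasFPowerSeriesOnBall.hasFPowerSeriesAt
  have h3 := congrArg (fun p => p.coeff n) h2
  simp only [FormalMultilinearSeries.coeff_ofScalars] at h3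
  exact h3

lemma HasDiscSeries.congr {b : ℕ → ℂ} (h : HasDiscSeries a F) (hab : ∀ n, a n = b n) :
    HasDiscSeries b F := by
  rwa [funext hab] at h

lemma HasDiscSeries.eqOn {G : ℂ → ℂ} (h : HasDiscSeries a F) (h' : HasDiscSeries a G) :
    EqOn F G disc := fun z hz => (h z hz).unique (h' z hz)

lemma HasDiscSeries.mul_deriv (h : HasDiscSeries a F) :
    HasDiscSeries (fun n => n * a n) (fun z => z * deriv F z) := by
  intro z hz
  have h1 := (h.isAnalytic.deriv.hasDiscSeries z hz).mul_left z
  rw [← hasSum_nat_add_iff' 1]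
  simp only [Finset.range_one, Finset.sum_singleton, Nat.cast_zero, zero_mul, sub_zero]
  refine HasSum.congr_fun h1 fun n => ?_
  rw [← h.taylorCoeff_eq (n + 1), taylorCoeff, taylorCoeff, iteratedDeriv_succ',
    Nat.factorial_succ]
  have : ((n : ℂ) + 1) ≠ 0 := by exact_mod_cast n.succ_ne_zero
  have : (n.factorial : ℂ) ≠ 0 := by exact_mod_cast n.factorial_ne_zero
  push_cast
  field_simp
  ring

lemma HasDiscSeries.chain {β : ℝ} (h : HasDiscSeries a F) :
    HasDiscSeries (fun n => (1 + n / (β : ℂ)) * a n) (chain β F 1) := by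
  intro z hz
  have := (h z hz).add ((h.mul_deriv z hz).div_const (β : ℂ))
  simp only [Libera.chain, Complex.ofReal_one, one_mul]
  refine HasSum.congr_fun this fun n => ?_
  ring

/-- Shifting the coefficients and multiplying them by a bounded sequence preserves convergence in
the disc. -/
lemma HasDiscSeries.exists_shift_mul (h : HasDiscSeries a F) {b : ℕ → ℂ} {C : ℝ}
    (hb : ∀ n, ‖b n‖ ≤ C) : ∃ D, HasDiscSeries (fun n => a (n + 1) * b n) D := by
  refine ⟨fun z => ∑' n, a (n + 1) * b n * z ^ n, fun z hz => Summable.hasSum ?_⟩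
  obtain ⟨r, hr, hr1⟩ := exists_between (mem_ball_zero_iff.1 hz)
  have hr0 : 0 < r := (norm_nonneg z).trans_lt hr
  have h1 := (((summable_nat_add_iff 1).2 (h.summable_norm hr0.le hr1)).mul_left (C * r⁻¹))
  refine Summable.of_norm_bounded h1 fun n => ?_
  have h2 : C * r⁻¹ * (‖a (n + 1)‖ * r ^ (n + 1)) = ‖a (n + 1)‖ * C * r ^ n := by
    rw [pow_succ]
    field_simp
  rw [h2, norm_mul, norm_mul, norm_pow]
  have := (norm_nonneg (b 0)).trans (hb 0)
  gcongr
  exact hb n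

end series

/-! ### The Bessel and Libera operators -/

/-- The coefficients of the normalised Bessel function are bounded, being absolutely summable by the
ratio test. -/
lemma exists_norm_bessel_le (κ x : ℂ) :
    ∃ C : ℝ, ∀ n : ℕ, ‖x ^ n / ((ascPochhammer ℂ n).eval κ * (n.factorial : ℂ))‖ ≤ C := by
  set b : ℕ → ℂ := fun n => x ^ n / ((ascPochhammer ℂ n).eval κ * (n.factorial : ℂ)) with hb
  have hrec : ∀ n, b (n + 1) = x / ((κ + n) * (n + 1)) * b n := by
    intro n
    simp only [hb]
    rw [ascPochhammer_succ_eval, Nat.factorial_succ, pow_succ]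
    push_cast
    rw [div_mul_div_comm]
    ring
  have hs : Summable b := by
    refine summable_of_ratio_norm_eventually_le (r := 1 / 2) (by norm_num) ?_
    filter_upwards [eventually_ge_atTop ⌈‖κ‖ + 1⌉₊, eventually_ge_atTop ⌈2 * ‖x‖⌉₊] with n h1 h2
    rw [Nat.ceil_le] at h1 h2
    rw [hrec, norm_mul, norm_div, norm_mul]
    have h3 : 1 ≤ ‖κ + n‖ := by
      have := norm_sub_norm_le (n : ℂ) (-κ)
      rw [norm_neg, Complex.norm_natCast, sub_neg_eq_add, add_comm (n : ℂ)] at this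
      linarith
    have h4 : ‖(n : ℂ) + 1‖ = n + 1 := by
      rw [← Nat.cast_succ, Complex.norm_natCast, Nat.cast_succ]
    rw [h4]
    refine mul_le_mul_of_nonneg_right ?_ (norm_nonneg _)
    rw [div_le_iff₀ (by positivity)]
    nlinarith
  exact ⟨∑' n, ‖b n‖, fun n => hs.norm.le_tsum n fun _ _ => norm_nonneg _⟩

/-- The power series of `B_{κ,c}(f)(z) / z`. -/
lemma hasDiscSeries_divZ_besselOp (κ c : ℂ) {f : ℂ → ℂ} (hf : IsAnalytic f) :
    HasDiscSeries (fun n => taylorCoeff f (n + 1) *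
      ((-c / 4) ^ n / ((ascPochhammer ℂ n).eval κ * (n.factorial : ℂ))))
      (divZ (besselOp κ c f)) := by
  obtain ⟨C, hC⟩ := exists_norm_bessel_le κ (-c / 4)
  obtain ⟨D, hD⟩ := hf.hasDiscSeries.exists_shift_mul hC
  have hB : ∀ z ∈ disc, besselOp κ c f z = z * D z := by
    intro z hz
    rw [besselOp, ← ((hD z hz).mul_left z).tsum_eq]
    refine tsum_congr fun n => ?_
    rw [pow_succ]
    ring
  have hdiv : EqOn D (divZ (besselOp κ c f)) disc := by
    intro z hz
    unfold divZ
    split_ifs with h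
    · subst h
      have h1 : HasDerivAt (fun z => z * D z) (D 0) 0 := by
        have := (hasDerivAt_id (0 : ℂ)).mul (hD.isAnalytic.differentiableAt hz).hasDerivAt
        simpa only [id, one_mul, zero_mul, add_zero] using! this
      refine (h1.congr_of_eventuallyEq ?_).deriv.symm
      filter_upwards [isOpen_ball.mem_nhds hz] with z hz using hB z hz
    · rw [hB z hz, mul_div_cancel_left₀ _ h]
  intro z hz
  rw [← hdiv hz]
  exact hD z hz

lemma ofReal_mul_cpow {s : ℝ} (hs : 0 < s) {z : ℂ} (hz : z ≠ 0) (w : ℂ) :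
    ((s : ℂ) * z) ^ w = (s : ℂ) ^ w * z ^ w := by
  have hs0 : (s : ℂ) ≠ 0 := by exact_mod_cast hs.ne'
  rw [Complex.cpow_def_of_ne_zero (mul_ne_zero hs0 hz), Complex.cpow_def_of_ne_zero hs0,
    Complex.cpow_def_of_ne_zero hz, Complex.log_ofReal_mul hs hz, ← Complex.exp_add,
    Complex.ofReal_log hs.le]
  ring_nf

/-- Termwise integration: the operator `F_μ` multiplies the coefficient of `zⁿ` by
`(μ + 1) / (μ + n)`. -/
lemma hasDiscSeries_libera {μ : ℝ} (hμ : -1 < μ) {f : ℂ → ℂ} (hf : IsAnalytic f) (hf0 : f 0 = 0) :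
    HasDiscSeries (fun n => ((μ : ℂ) + 1) / (μ + n) * taylorCoeff f n) (libera μ f) := by
  set a := taylorCoeff f with ha
  have ha0 : a 0 = 0 := by simp [ha, taylorCoeff, hf0]
  intro z hz
  have hsum : ∀ z ∈ disc, HasSum (fun n => a (n + 1) * z ^ (n + 1)) (f z) := fun z hz => by
    have := (hasSum_nat_add_iff' 1).2 (hf.hasDiscSeries z hz)
    simpa [← ha, ha0] using this
  rw [← hasSum_nat_add_iff' 1]
  simp only [Finset.range_one, Finset.sum_singleton, ha0, mul_zero, zero_mul, sub_zero]
  rcases eq_or_ne z 0 with rfl | hz0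
  · -- At the origin both sides vanish, whatever the value of `0 ^ μ`.
    simp [libera, hasSum_zero]
  have hn : ∀ n : ℕ, -1 < μ + n := fun n => by
    have : (0 : ℝ) ≤ n := n.cast_nonneg
    linarith
  set G : ℕ → ℝ → ℂ := fun n s => a (n + 1) * z ^ (n + 1) * ((s ^ (μ + n) : ℝ) : ℂ) with hG
  have hint : ∀ n, Integrable (G n) (volume.restrict (Ioc 0 1)) := fun n => by
    have h1 := (intervalIntegral.intervalIntegrable_rpow' (a := 0) (b := 1) (hn n)).1
    exact h1.ofReal.const_mul _
  have hrpow : ∀ n : ℕ, ∫ s in Ioc (0 : ℝ) 1, s ^ (μ + n) = 1 / (μ + n + 1) := fun n => by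
    rw [← intervalIntegral.integral_of_le zero_le_one, integral_rpow (Or.inl (hn n)),
      Real.one_rpow, Real.zero_rpow (by linarith [hn n]), sub_zero]
  have hnorm : ∀ n, ∫ s in Ioc (0 : ℝ) 1, ‖G n s‖
      = ‖a (n + 1) * z ^ (n + 1)‖ * (1 / (μ + n + 1)) := by
    intro n
    rw [← hrpow n, ← integral_const_mul]
    refine setIntegral_congr_fun measurableSet_Ioc fun s hs => ?_
    simp only [hG]
    rw [norm_mul _ ((s ^ (μ + n) : ℝ) : ℂ), Complex.norm_real, Real.norm_eq_abs,
      abs_of_nonneg (Real.rpow_nonneg hs.1.le _)]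
  have hsumm : Summable fun n => ∫ s in Ioc (0 : ℝ) 1, ‖G n s‖ := by
    simp only [hnorm]
    refine Summable.of_nonneg_of_le (fun n => ?_) (fun n => ?_)
      ((hsum z hz).summable.norm.mul_right (1 / (μ + 1)))
    · have := hn n
      exact mul_nonneg (norm_nonneg _) (one_div_nonneg.2 (by linarith))
    · refine mul_le_mul_of_nonneg_left ?_ (norm_nonneg _)
      have : (0 : ℝ) ≤ n := n.cast_nonneg
      exact one_div_le_one_div_of_le (by linarith) (by linarith)
  have hmain := hasSum_integral_of_summable_integral_norm hint hsumm
  have hG' : ∀ n, ∫ s in Ioc (0 : ℝ) 1, G n s = a (n + 1) * z ^ (n + 1) * (1 / (μ + n + 1)) := by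
    intro n
    simp only [hG]
    rw [integral_const_mul, integral_complex_ofReal, hrpow]
    push_cast
    ring
  have hlib : libera μ f z = (μ + 1) * ∫ s in Ioc (0 : ℝ) 1, ∑' n, G n s := by
    have hzμ : z ^ (μ : ℂ) ≠ 0 := by simp [Complex.cpow_eq_zero_iff, hz0]
    rw [libera, intervalIntegral.integral_of_le zero_le_one, div_mul_eq_mul_div, mul_div_assoc,
      div_eq_inv_mul, ← integral_const_mul]
    congr 1
    refine setIntegral_congr_fun measurableSet_Ioc fun s hs => ?_
    have hsz : (s : ℂ) * z ∈ disc := by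
      refine mem_disc_of_norm_le hz ?_
      rw [norm_mul, Complex.norm_real, Real.norm_eq_abs, abs_of_pos hs.1]
      exact mul_le_of_le_one_left (norm_nonneg z) hs.2
    have hs0 : (s : ℂ) ≠ 0 := by exact_mod_cast hs.1.ne'
    have h1 : HasSum (fun n => G n s) ((s : ℂ) ^ ((μ : ℂ) - 1) * f (s * z)) := by
      refine HasSum.congr_fun ((hsum _ hsz).mul_left _) fun n => ?_
      have h2 : (s : ℂ) ^ ((μ : ℂ) + n) = (s : ℂ) ^ ((μ : ℂ) - 1) * s ^ (n + 1) := by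
        rw [← Complex.cpow_natCast, ← Complex.cpow_add _ _ hs0]
        push_cast
        ring_nf
      simp only [hG]
      rw [Complex.ofReal_cpow hs.1.le, Complex.ofReal_add, Complex.ofReal_natCast, h2, mul_pow]
      ring
    rw [h1.tsum_eq, ofReal_mul_cpow hs.1 hz0, Complex.cpow_sub _ _ hz0, Complex.cpow_one]
    field_simp
  rw [hlib]
  simp only [hG'] at hmain
  refine HasSum.congr_fun (hmain.mul_left ((μ : ℂ) + 1)) fun n => ?_
  push_cast
  rw [← add_assoc]
  ring

/-- The relation `φ + z φ' / (μ + 1) = ω` between the quotients attached to `F_μ(f)` and `f`. -/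
lemma eqOn_chain_libera (κ c : ℂ) {μ : ℝ} (hμ : -1 < μ) {f : ℂ → ℂ} (hf : ClassA f) :
    IsAnalytic (divZ (besselOp κ c (libera μ f))) ∧
      EqOn (divZ (besselOp κ c f))
        (chain (μ + 1) (divZ (besselOp κ c (libera μ f))) 1) disc := by
  have hL := hasDiscSeries_libera hμ hf.1.1 hf.2.1
  have hφ := hasDiscSeries_divZ_besselOp κ c hL.isAnalytic
  refine ⟨hφ.isAnalytic, (hasDiscSeries_divZ_besselOp κ c hf.1.1).eqOn (hφ.chain.congr fun n => ?_)⟩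
  rw [hL.taylorCoeff_eq]
  have h1 : ((μ : ℂ) + 1) ≠ 0 := by exact_mod_cast (by linarith : μ + 1 ≠ 0)
  have h2 : ((μ : ℂ) + (n + 1)) ≠ 0 := by
    have : (0 : ℝ) ≤ n := n.cast_nonneg
    exact_mod_cast (by linarith : μ + (n + 1) ≠ 0)
  push_cast
  field_simp
  ring

lemma gammaConst_bounds {μ : ℝ} (hμ : -1 < μ) :
    4 * gammaConst μ ≤ μ + 1 ∧ 4 * gammaConst μ * (μ + 1) ≤ 1 := by
  have hβ : 0 < μ + 1 := by linarith
  have h1 : (1 : ℝ) ≤ √(1 + (μ + 1) ^ 4) := Real.le_sqrt_of_sq_le (by nlinarith [pow_pos hβ 4])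
  have h2 : (μ + 1) ^ 2 ≤ √(1 + (μ + 1) ^ 4) := Real.le_sqrt_of_sq_le (by nlinarith)
  have h3 : 4 * gammaConst μ * (μ + 1) = 1 + (μ + 1) ^ 2 - √(1 + (μ + 1) ^ 4) := by
    unfold gammaConst
    field_simp
  refine ⟨?_, by linarith⟩
  refine le_of_mul_le_mul_right ?_ hβ
  nlinarith

/-- The hypothesis on `ω` makes the solution `φ` of `φ + z φ' / (μ + 1) = ω` convex. -/
lemma isConvexMap_of_eqOn_chain {μ : ℝ} (hμ : -1 < μ) {φ ω : ℂ → ℂ} (hφ : IsAnalytic φ)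
    (hω : EqOn ω (chain (μ + 1) φ 1) disc)
    (h : ∀ z ∈ disc, deriv ω z ≠ 0 ∧
      -gammaConst μ < (z * deriv (deriv ω) z / deriv ω z + 1).re) : IsConvexMap φ := by
  obtain ⟨h1, h2⟩ := gammaConst_bounds hμ
  have hd : EqOn (deriv ω) (deriv (chain (μ + 1) φ 1)) disc := hω.deriv isOpen_ball
  refine isConvexMap_of_chain (by linarith) hφ h1 h2 fun z hz => ?_
  rw [← hd hz, ← hd.deriv isOpen_ball hz]
  exact h z hz

end Libera

theorem mainTheorem3 (b p c κ : ℂ) (hκ : κ = p + (b + 1) / 2)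
    (hκ_pole : ∀ n : ℕ, κ ≠ -(n : ℂ)) (hc : c ≠ 0)
    (μ : ℝ) (hμ : -1 < μ)
    (f g₁ g₂ : ℂ → ℂ)
    (hf : Libera.ClassA f) (hg₁ : Libera.ClassA g₁) (hg₂ : Libera.ClassA g₂)
    (ω₁ ω₂ : ℂ → ℂ)
    (hω₁ : ω₁ = Libera.divZ (Libera.besselOp κ c g₁))
    (hω₂ : ω₂ = Libera.divZ (Libera.besselOp κ c g₂))
    (hconv₁ : ∀ z ∈ Libera.disc, deriv ω₁ z ≠ 0 ∧
      -Libera.gammaConst μ < (z * deriv (deriv ω₁) z / deriv ω₁ z + 1).re)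
    (hconv₂ : ∀ z ∈ Libera.disc, deriv ω₂ z ≠ 0 ∧
      -Libera.gammaConst μ < (z * deriv (deriv ω₂) z / deriv ω₂ z + 1).re)
    (hf_univ : Libera.IsUnivalent (Libera.divZ (Libera.besselOp κ c f)))
    (hf_H : Libera.ClassH 1 1 (Libera.divZ (Libera.besselOp κ c (Libera.libera μ f))))
    (hf_Q : Libera.ClassQ (Libera.divZ (Libera.besselOp κ c (Libera.libera μ f)))) :
    (Libera.Subordinate ω₁ (Libera.divZ (Libera.besselOp κ c f)) ∧
        Libera.Subordinate (Libera.divZ (Libera.besselOp κ c f)) ω₂ →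
      Libera.Subordinate (Libera.divZ (Libera.besselOp κ c (Libera.libera μ g₁)))
          (Libera.divZ (Libera.besselOp κ c (Libera.libera μ f))) ∧
        Libera.Subordinate (Libera.divZ (Libera.besselOp κ c (Libera.libera μ f)))
          (Libera.divZ (Libera.besselOp κ c (Libera.libera μ g₂)))) ∧
    Libera.IsBestSubordinant (fun u v => u + v / ((μ : ℂ) + 1)) ω₁
      (Libera.divZ (Libera.besselOp κ c (Libera.libera μ g₁))) ∧
    Libera.IsBestDominant (fun u v => u + v / ((μ : ℂ) + 1)) ω₂
      (Libera.divZ (Libera.besselOp κ c (Libera.libera μ g₂))) := by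

  have hβ : 0 < μ + 1 := by linarith
  have hcast : (μ : ℂ) + 1 = ((μ + 1 : ℝ) : ℂ) := by push_cast; rfl
  obtain ⟨hφ₁, hφω₁⟩ := Libera.eqOn_chain_libera κ c hμ hg₁
  obtain ⟨hφ₂, hφω₂⟩ := Libera.eqOn_chain_libera κ c hμ hg₂
  obtain ⟨hP, hPH⟩ := Libera.eqOn_chain_libera κ c hμ hf
  rw [← hω₁] at hφω₁
  rw [← hω₂] at hφω₂
  have hc₁ := Libera.isConvexMap_of_eqOn_chain hμ hφ₁ hφω₁ hconv₁
  have hc₂ := Libera.isConvexMap_of_eqOn_chain hμ hφ₂ hφω₂ hconv₂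
  rw [hcast]
  refine ⟨fun h => ⟨?_, ?_⟩, hc₁.isBestSubordinant hβ hφω₁, hc₂.isBestDominant hβ hφω₂⟩
  · -- A function of class `Q` is univalent in the disc.
    have hPinj : Set.InjOn (Libera.divZ (Libera.besselOp κ c (Libera.libera μ f))) Libera.disc := by
      obtain ⟨G, hG, -, hGinj, -⟩ := hf_Q
      refine (hGinj.mono fun z hz => ?_).congr hG
      exact ⟨Metric.ball_subset_closedBall hz, fun he => (mem_ball_zero_iff.1 hz).ne he.1⟩
    exact hc₁.subordinate_of_superordination hβ ⟨hP, hPinj⟩ (hf_univ.congr hPH).2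
      (h.1.congr hφω₁ hPH)
  · exact hc₂.subordinate_of_chain hβ hP (h.2.congr hPH hφω₂)
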